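/- **Game.** Consider a finite $n$-player extensive-form game with chance moves, imperfect information and perfect recall: a finite rooted tree with terminal nodes $Z$, payoffs $u^{(i)}(z)$, the product $p_c(z)$ of the chance probabilities on the path to $z$, nonempty information sets $j\in\mathcal J^{(i)}$ of player $i$ and nonempty action sets $A(j)$. Let $\Sigma^{(i)}_*=\{(j,a): j\in\mathcal J^{(i)},a\in A(j)\}$ and $\Sigma^{(i)}=\Sigma_*^{(i)}\cup\{\varnothing\}$ be the sequences of player $i$; $\sigma^{(i)}(j)$ and $\sigma^{(i)}(z)$ denote the last sequence of player $i$ on the path to $j$ and to $z$. Write $j\prec j'$ if the path to $j'$ passes through $j$, $j\preceq(j',a')$ if $j\preceq j'$, and $(j,a)\preceq(j',a')$ if $(j,a)=(j',a')$ or player $i$ plays $a$ at $j$ on the path to $j'$ (while $j\not\preceq\varnothing$ and $(j,a)\not\preceq\varnothing$). **Strategies.** $\mathcal Q^{(i)}$ is the set of $q\in\mathbb R_{\ge0}^{\Sigma^{(i)}}$ with $q[\varnothing]=1$ and $q[\sigma^{(i)}(j)]=\sum_{a\in A(j)}q[(j,a)]$ for all $j$. $\mathcal Q^{(i)}_j$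 is the set of $q\in\mathbb R_{\ge0}^{\{\sigma:\sigma\succeq j\}}$ with $\sum_{a\in A(j)} q[(j,a)]=1$ and $q[\sigma^{(i)}(j')]=\sum_{a\in A(j')}q[(j',a)]$ for all $j'\succ j$. $\Pi^{(i)}$ and $\Pi^{(i)}_j$ are the $0/1$-valued elements of these sets, and $\Pi=\prod_i\Pi^{(i)}$. **Equilibrium.** A probability distribution $\mu$ on $\Pi$ is an *EFCE* if for every player $i$, every $\hat\sigma=(j,a)\in\Sigma^{(i)}_*$ and every $\hat\pi\in\Pi^{(i)}_j$, $$\sum_{z:\,\sigma^{(i)}(z)\succeq\hat\sigma}u^{(i)}(z)p_c(z)\sum_{\substack{\pi\in\Pi:\ \pi^{(i')}[\sigma^{(i')}(z)]=1\\ \forall i'}}\mu[\pi]\ \ge\sum_{z:\,\sigma^{(i)}(z)\succeq j}u^{(i)}(z)p_c(z)\,\hat\pi[\sigma^{(i)}(z)]\sum_{\substack{\pi\in\Pi:\ \pi^{(i)}[\hat\sigma]=1,\\ \pi^{(i')}[\sigma^{(i')}(z)]=1\ \forall i'\ne i}}\mu[\pi].$$ **Algorithm of player $i$.** For $\hat\sigma=(j,a)\in\Sigma_*^{(i)}$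 and a vector $y$, let $M_{\hat\sigma\to y}$ be the $\Sigma^{(i)}\times\Sigma^{(i)}$ matrix whose entry $[\sigma_r,\sigma_c]$ is $1$ if $\sigma_c\not\succeq\hat\sigma$ and $\sigma_r=\sigma_c$, is $y[\sigma_r]$ if $\sigma_c=\hat\sigma$ and $\sigma_r\succeq j$, and is $0$ otherwise. The algorithm uses a regret minimizer $\mathcal R_\Delta$ for the simplex $\Delta(\Sigma^{(i)}_*)$ and, for each $\hat\sigma=(j,a)\in\Sigma^{(i)}_*$, a regret minimizer $\mathcal R_{\hat\sigma}$ for $\mathcal Q^{(i)}_j$. At time $t$: 1. Obtain $\lambda^t$ from $\mathcal R_\Delta$ and $q^t_{\hat\sigma}$ from each $\mathcal R_{\hat\sigma}$, and set $\phi^t=\sum_{\hat\sigma}\lambda^t_{\hat\sigma}M_{\hat\sigma\to q^t_{\hat\sigma}}$. 2. Compute $q^t\in\mathcal Q^{(i)}$ with $\phi^tq^t=q^t$ as follows. Start with $x[\varnothing]=1$ and all other entries $0$. Visit the information sets $j$ in an order in which $j$ comes before $j'$ whenever $j\prec j'$. At $j$, let $\sigma_p=\sigma^{(i)}(j)$;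 if $x[\sigma_p]=0$, set $x[(j,a)]=0$ for all $a$; otherwise set $x[(j,a)]=x[\sigma_p]\,b[a]$, where $b\in\Delta(A(j))$ is the fixed point returned by a given oracle (which maps each column-stochastic matrix to a fixed point in the simplex) for the column-stochastic matrix $W/x[\sigma_p]$ with $$W[a_r,a_c]=r[a_r]+\Big(\lambda^t_{(j,a_c)}q^t_{(j,a_c)}[(j,a_r)]+\Big(1-\sum_{\hat\sigma\preceq(j,a_c)}\lambda^t_{\hat\sigma}\Big)\mathbf 1[a_r=a_c]\Big)x[\sigma_p],$$ $$r[a]=\sum_{j'\preceq\sigma_p}\sum_{a'\in A(j')}\lambda^t_{(j',a')}\,q^t_{(j',a')}[(j,a)]\,x[(j',a')].$$ 3. Sample $\pi^{(i),t}\in\Pi^{(i)}$ from $q^t$: starting from the information sets with $\sigma^{(i)}(j)=\varnothing$, draw at each visited $j$ an action $a$ with probability $q^t[(j,a)]/q^t[\sigma^{(i)}(j)]$ and then visit all $j'$ with $\sigma^{(i)}(j')=(j,a)$; put $\pi^{(i),t}=1$ at $\varnothing$ and at the drawn pairs, and $0$ elsewhere. 4. Observe the linear utility $$\ell^{(i),t}(x)=\sum_{z\in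 Z}u^{(i)}(z)p_c(z)\Big(\prod_{i'\ne i}\pi^{(i'),t}[\sigma^{(i')}(z)]\Big)x[\sigma^{(i)}(z)],$$ form $L^t(M)=\ell^{(i),t}(Mq^t)$, pass $x\mapsto L^t(M_{\hat\sigma\to x})-L^t(M_{\hat\sigma\to0})$ to $\mathcal R_{\hat\sigma}$ for each $\hat\sigma$, and pass $\lambda\mapsto\sum_{\hat\sigma}\lambda_{\hat\sigma}L^t(M_{\hat\sigma\to q^t_{\hat\sigma}})$ to $\mathcal R_\Delta$. Given the first $t-1$ joint strategies, the players sample independently at time $t$. **Theorem.** Suppose that for each player either $\mathcal R_\Delta$ is regret matching and every $\mathcal R_{\hat\sigma}$ is the counterfactual regret minimization algorithm (CFR), or $\mathcal R_\Delta$ and all $\mathcal R_{\hat\sigma}$ are arbitrary deterministic regret minimizers for their sets, that is, causal rules with outputs in the set $X$ in question (whenever $X\neq\emptyset$) such that for every bounded sequence of linear utilities $g^1,g^2,\dots$ with outputs $x^1,x^2,\dots$ one has $\limsup_{T\to\infty}\frac1T\sup_{x\in X}\sum_{t\le T}(g^t(x)-g^t(x^t))\le0$. If all players play infinitely many repetitions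 of the game according to this algorithm, then the empirical frequency of play $$\mu^T[\pi]=\frac1T\sum_{t=1}^T\mathbf 1\big[(\pi^{(1),t},\dots,\pi^{(n),t})=\pi\big],\qquad \pi\in\Pi,$$ converges almost surely, as $T\to\infty$, to the (nonempty) set of EFCEs: almost surely, the distance of $\mu^T$ in $\mathbb R^{\Pi}$ from the set of EFCEs tends to $0$. -/

import Mathlib

open scoped BigOperators Topology
open Filter MeasureTheory

/-! ## Finite game trees -/

/-- A finite rooted game tree with `n` players.  `Info i` labels the information sets of player `i`
and `Act i j` is the set of actions available at every node of the information set `j`.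
A node is terminal (with its payoffs), a chance node (with its distribution over `k` outcomes), or
a decision node of a player `i`, which lies in one of the information sets of `i`. -/
inductive GameTree {n : ℕ} (Info : Fin n → Type) (Act : (i : Fin n) → Info i → Type) : Type
  | terminal (payoff : Fin n → ℝ) : GameTree Info Act
  | chance (k : ℕ) (prob : Fin k → ℝ) (next : Fin k → GameTree Info Act) : GameTree Info Act
  | decision (i : Fin n) (j : Info i) (next : Act i j → GameTree Info Act) : GameTree Info Act

namespace GameTree

variable {n : ℕ} {Info : Fin n → Type} {Act : (i : Fin n) → Info i → Type}

/-- A move of some (non-chance) player: the player, the information set and the action. -/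
abbrev Move (Info : Fin n → Type) (Act : (i : Fin n) → Info i → Type) : Type :=
  (i : Fin n) × (j : Info i) × Act i j

/-- The (information set, action) pair of a move if the move was made by player `i`. -/
def moveOf (i : Fin n) (m : Move Info Act) : Option ((j : Info i) × Act i j) :=
  if h : m.1 = i then some (h ▸ m.2) else none

/-- The moves of player `i` among a list of moves. -/
def own (i : Fin n) (p : List (Move Info Act)) : List ((j : Info i) × Act i j) :=
  p.filterMap (moveOf i)

/-- `T.IsNode p S`: the tree `T` has a node with subtree `S`, and `p` is the list of the moves of
the players on the path from the root of `T` to that node, the most recent move first. -/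
inductive IsNode (T : GameTree Info Act) : List (Move Info Act) → GameTree Info Act → Prop
  | root : IsNode T [] T
  | chance {p : List (Move Info Act)} {k : ℕ} {prob : Fin k → ℝ}
      {next : Fin k → GameTree Info Act} (h : IsNode T p (.chance k prob next)) (c : Fin k) :
      IsNode T p (next c)
  | decision {p : List (Move Info Act)} {i : Fin n} {j : Info i}
      {next : Act i j → GameTree Info Act} (h : IsNode T p (.decision i j next)) (a : Act i j) :
      IsNode T (⟨i, j, a⟩ :: p) (next a)

/-- The terminal nodes of a tree. -/
def Leaf : GameTree Info Act → Type
  | .terminal _ => Unit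
  | .chance k _ next => (c : Fin k) × (next c).Leaf
  | .decision i j next => (a : Act i j) × (next a).Leaf

/-- There are finitely many terminal nodes. -/
@[reducible] def leafFintype [∀ i j, Fintype (Act i j)] : (T : GameTree Info Act) → Fintype T.Leaf
  | .terminal _ => inferInstanceAs (Fintype Unit)
  | .chance k _ next =>
      letI : ∀ c, Fintype (next c).Leaf := fun c => leafFintype (next c)
      inferInstanceAs (Fintype ((c : Fin k) × (next c).Leaf))
  | .decision i j next =>
      letI : ∀ a, Fintype (next a).Leaf := fun a => leafFintype (next a)
      inferInstanceAs (Fintype ((a : Act i j) × (next a).Leaf))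

/-- The payoff of each player at a terminal node. -/
def payoff : (T : GameTree Info Act) → T.Leaf → Fin n → ℝ
  | .terminal u, _ => u
  | .chance _ _ next, ⟨c, z⟩ => (next c).payoff z
  | .decision _ _ next, ⟨a, z⟩ => (next a).payoff z

/-- The product of the probabilities of the chance moves on the path to a terminal node. -/
def chanceProb : (T : GameTree Info Act) → T.Leaf → ℝ
  | .terminal _, _ => 1
  | .chance _ prob next, ⟨c, z⟩ => prob c * (next c).chanceProb z
  | .decision _ _ next, ⟨a, z⟩ => (next a).chanceProb z

/-- The moves of the players on the path to a terminal node, the most recent move first. -/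
def leafMoves : (T : GameTree Info Act) → T.Leaf → List (Move Info Act)
  | .terminal _, _ => []
  | .chance _ _ next, ⟨c, z⟩ => (next c).leafMoves z
  | .decision i j next, ⟨a, z⟩ => (next a).leafMoves z ++ [⟨i, j, a⟩]

end GameTree

/-- A finite `n`-player general-sum extensive-form game with chance, imperfect information and
perfect recall. -/
structure ExtensiveGame (n : ℕ) where
  Info : Fin n → Type
  Act : (i : Fin n) → Info i → Type
  [fintypeInfo : ∀ i, Fintype (Info i)]
  [decEqInfo : ∀ i, DecidableEq (Info i)]
  [fintypeAct : ∀ i j, Fintype (Act i j)]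
  [decEqAct : ∀ i j, DecidableEq (Act i j)]
  tree : GameTree Info Act
  /-- at every chance node a probability distribution is given -/
  chance_prob : ∀ p k prob next, tree.IsNode p (.chance k prob next) →
    (∀ c, 0 ≤ prob c) ∧ ∑ c, prob c = 1
  /-- information sets are nonempty sets of nodes -/
  info_nonempty : ∀ i j, ∃ p next, tree.IsNode p (.decision i j next)
  /-- decision nodes are not leaves -/
  act_nonempty : ∀ i j, Nonempty (Act i j)
  /-- what player `i` remembers at the information set `j`: the player's own earlier
  (information set, action) pairs, the most recent first -/
  past : (i : Fin n) → Info i → List ((j : Info i) × Act i j)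
  /-- perfect recall: at all nodes of an information set the player has the same past -/
  perfect_recall : ∀ i j p next, tree.IsNode p (.decision i j next) →
    GameTree.own i p = past i j

attribute [instance] ExtensiveGame.fintypeInfo ExtensiveGame.decEqInfo
  ExtensiveGame.fintypeAct ExtensiveGame.decEqAct ExtensiveGame.act_nonempty

/-! ## Online learning -/

/-- A deterministic online decision rule: it maps the utility vectors observed so far, in
chronological order, to the next element. -/
abbrev OnlineRule (ι : Type) : Type := List (ι → ℝ) → (ι → ℝ)

/-- `R` is a regret minimizer for the set `X`: it outputs elements of `X`, and against every bounded
sequence of linear utility functions (represented by vectors) its cumulative regret grows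
sublinearly.  (Nothing is asked for if `X` is empty, since no element could be output.) -/
def IsRegretMinimizer {ι : Type} [Fintype ι] (X : Set (ι → ℝ)) (R : OnlineRule ι) : Prop :=
  X.Nonempty →
    (∀ hist, R hist ∈ X) ∧
    ∀ ℓ : ℕ → ι → ℝ, (∃ B : ℝ, ∀ t a, |ℓ t a| ≤ B) →
      ∀ ε : ℝ, 0 < ε → ∀ᶠ T : ℕ in atTop, ∀ x ∈ X,
        ∑ t ∈ Finset.range T, (ℓ t ⬝ᵥ x - ℓ t ⬝ᵥ R ((List.range t).map ℓ)) ≤ ε * T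

open Classical in
/-- The regret-matching distribution: proportional to the positive parts of the cumulative regrets,
uniform if there is no positive regret. -/
noncomputable def regretMatch {ι : Type} [Fintype ι] (r : ι → ℝ) : ι → ℝ :=
  if ∑ b, max (r b) 0 = 0 then fun _ => 1 / (Fintype.card ι : ℝ)
  else fun a => max (r a) 0 / ∑ b, max (r b) 0

/-- The regret matching algorithm for the simplex over `ι`. -/
noncomputable def regretMatching {ι : Type} [Fintype ι] : OnlineRule ι := fun hist =>
  regretMatch (hist.foldl (fun r ℓ a => r a + (ℓ a - ℓ ⬝ᵥ regretMatch r)) 0)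

/-- An oracle that maps every column-stochastic matrix to a fixed point in the simplex. -/
def IsFixedPointOracle {ι : Type} [Fintype ι] (F : Matrix ι ι ℝ → ι → ℝ) : Prop :=
  ∀ M : Matrix ι ι ℝ, (∀ r c, 0 ≤ M r c) → (∀ c, ∑ r, M r c = 1) →
    F M ∈ stdSimplex ℝ ι ∧ M.mulVec (F M) = F M

namespace ExtensiveGame

variable {n : ℕ} (G : ExtensiveGame n)

/-! ## Sequences -/

/-- The nonempty sequences of player `i`; the pair `(j, a)` stands for the sequence of the player's
actions down to action `a` at `j`. -/
abbrev Trig (i : Fin n) : Type := (j : G.Info i) × G.Act i j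

/-- The sequences of player `i`; `none` is the empty sequence. -/
abbrev Seq (i : Fin n) : Type := Option (G.Trig i)

/-- The terminal nodes. -/
abbrev Z : Type := G.tree.Leaf

noncomputable instance : Fintype G.Z := GameTree.leafFintype G.tree

/-- The last sequence of player `i` on the path to the terminal node `z`. -/
def seqZ (i : Fin n) (z : G.Z) : G.Seq i := (GameTree.own i (G.tree.leafMoves z)).head?

variable {G} {i : Fin n}

/-- The last sequence of player `i` on the path to (any node of) the information set `j`. -/
def seqI (j : G.Info i) : G.Seq i := (G.past i j).head?

/-- `j ≺ j'`: the path to (any node of) `j'` passes through `j`. -/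
def InfoLT (j j' : G.Info i) : Prop := ∃ a, (⟨j, a⟩ : G.Trig i) ∈ G.past i j'

/-- `j ≼ j'`. -/
def InfoLE (j j' : G.Info i) : Prop := j = j' ∨ InfoLT j j'

/-- `j ≼ σ`: `σ` is a nonempty sequence ending at `j` or at a descendant of `j`. -/
def InfoLESeq (j : G.Info i) (σ : G.Seq i) : Prop := ∃ τ : G.Trig i, σ = some τ ∧ InfoLE j τ.1

/-- `τ ≼ σ` for a nonempty sequence `τ`. -/
def TrigLE (τ : G.Trig i) (σ : G.Seq i) : Prop :=
  ∃ τ' : G.Trig i, σ = some τ' ∧ (τ = τ' ∨ τ ∈ G.past i τ'.1)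

/-! ## Sequence-form strategies -/

variable (G) in
/-- The sequence-form strategy polytope of player `i`. -/
def Q (i : Fin n) : Set (G.Seq i → ℝ) :=
  {q | (∀ σ, 0 ≤ q σ) ∧ q none = 1 ∧ ∀ j : G.Info i, q (seqI j) = ∑ a, q (some ⟨j, a⟩)}

/-- Sequence-form strategies for the subtree rooted at `j`.  Vectors indexed by the sequences
`σ ≽ j` are extended by zero to all sequences. -/
def QSub (j : G.Info i) : Set (G.Seq i → ℝ) :=
  {q | (∀ σ, 0 ≤ q σ) ∧ (∀ σ, ¬ InfoLESeq j σ → q σ = 0) ∧ ∑ a, q (some ⟨j, a⟩) = 1 ∧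
    ∀ j' : G.Info i, InfoLT j j' → q (seqI j') = ∑ a, q (some ⟨j', a⟩)}

variable (G) in
/-- Deterministic sequence-form strategies of player `i`. -/
def Pure (i : Fin n) : Set (G.Seq i → ℝ) := {q | q ∈ G.Q i ∧ ∀ σ, q σ = 0 ∨ q σ = 1}

/-- Deterministic sequence-form strategies for the subtree rooted at `j`. -/
def PureSub (j : G.Info i) : Set (G.Seq i → ℝ) := {q | q ∈ QSub j ∧ ∀ σ, q σ = 0 ∨ q σ = 1}

variable (G) in
theorem pure_finite (i : Fin n) : (G.Pure i).Finite := by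
  refine Set.Finite.subset (Set.Finite.pi' (t := fun _ : G.Seq i => ({0, 1} : Set ℝ))
    (fun _ => Set.toFinite _)) ?_
  intro q hq σ
  simpa using hq.2 σ

noncomputable instance (i : Fin n) : Fintype (G.Pure i) := (G.pure_finite i).fintype

variable (G) in
/-- Joint deterministic sequence-form strategies. -/
abbrev Profile : Type := (i : Fin n) → G.Pure i

/-! ## Extensive-form correlated equilibrium -/

open Classical in
/-- Probability of ending in `z` (up to chance) if all players follow the recommendations. -/
noncomputable def reach (μ : G.Profile → ℝ) (z : G.Z) : ℝ :=
  ∑ π : G.Profile with ∀ i, (π i).1 (G.seqZ i z) = 1, μ π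

open Classical in
/-- Probability of ending in `z` (up to chance) for the trigger agent of player `i` with trigger
sequence `τ` and continuation strategy `ρ`, where `z` passes through the information set of `τ`. -/
noncomputable def reachTrig (μ : G.Profile → ℝ) (τ : G.Trig i) (ρ : G.Seq i → ℝ) (z : G.Z) : ℝ :=
  (∑ π : G.Profile with (∀ i', i' ≠ i → (π i').1 (G.seqZ i' z) = 1) ∧ (π i).1 (some τ) = 1, μ π)
    * ρ (G.seqZ i z)

variable (G) in
open Classical in
/-- `ε`-approximate extensive-form correlated equilibria. -/
def IsApproxEFCE (ε : ℝ) (μ : G.Profile → ℝ) : Prop :=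
  μ ∈ stdSimplex ℝ G.Profile ∧
  ∀ (i : Fin n) (τ : G.Trig i), ∀ ρ ∈ PureSub τ.1,
    ∑ z : G.Z with TrigLE τ (G.seqZ i z),
        G.tree.payoff z i * G.tree.chanceProb z * reach μ z
      ≥ ∑ z : G.Z with InfoLESeq τ.1 (G.seqZ i z),
        G.tree.payoff z i * G.tree.chanceProb z * reachTrig μ τ ρ z - ε

variable (G) in
/-- The set of extensive-form correlated equilibria. -/
def EFCE : Set (G.Profile → ℝ) := {μ | G.IsApproxEFCE 0 μ}

/-! ## Canonical trigger deviation functions -/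

open Classical in
/-- The matrix of the canonical trigger deviation with trigger `τ` and continuation `y`. -/
noncomputable def devMatrix (τ : G.Trig i) (y : G.Seq i → ℝ) : Matrix (G.Seq i) (G.Seq i) ℝ :=
  fun r c =>
    if ¬ TrigLE τ c ∧ r = c then 1
    else if c = some τ ∧ InfoLESeq τ.1 r then y r
    else 0

/-! ## Counterfactual regret minimization on the subtree rooted at an information set -/

open Classical in
/-- The sequence-form strategy for the subtree rooted at `j` of the behavioral strategy `b`. -/
noncomputable def toSeqForm (j : G.Info i) (b : (j' : G.Info i) → G.Act i j' → ℝ) :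
    G.Seq i → ℝ
  | none => 0
  | some τ =>
      if InfoLE j τ.1 then
        (((τ :: G.past i τ.1).filter (fun τ' => decide (InfoLE j τ'.1))).map
          (fun τ' => b τ'.1 τ'.2)).prod
      else 0

/-- One update of the cumulative counterfactual regrets `R` on observing the utility vector `g`:
the current behavioral strategy `b` is given by regret matching at each information set, and the
regret of action `a` at `j'` grows by the difference between the counterfactual value at `j'` of
playing `a` at `j'` and following `b` afterwards, and that of following `b`. -/
noncomputable def cfrStep (R : (j' : G.Info i) → G.Act i j' → ℝ) (g : G.Seq i → ℝ) :
    (j' : G.Info i) → G.Act i j' → ℝ :=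
  let b : (j' : G.Info i) → G.Act i j' → ℝ := fun j' => regretMatch (R j')
  fun j' a => R j' a +
    (g ⬝ᵥ toSeqForm j' (Function.update b j' (Pi.single a 1)) - g ⬝ᵥ toSeqForm j' b)

/-- The counterfactual regret minimization (CFR) algorithm for the set `QSub j`. -/
noncomputable def cfr (j : G.Info i) : OnlineRule (G.Seq i) := fun hist =>
  toSeqForm j (fun j' => regretMatch (hist.foldl cfrStep 0 j'))

/-! ## Fixed points of trigger deviation functions -/

open Classical in
/-- The algorithm Extend for the transformation `∑ τ, lam τ • devMatrix τ (y τ)`: it fills in the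
entries of the partial fixed point `x` at the information set `j`. -/
noncomputable def extend (F : (j : G.Info i) → Matrix (G.Act i j) (G.Act i j) ℝ → G.Act i j → ℝ)
    (lam : G.Trig i → ℝ) (y : G.Trig i → G.Seq i → ℝ)
    (x : G.Seq i → ℝ) (j : G.Info i) : G.Seq i → ℝ :=
  let xp : ℝ := x (seqI j)
  let r : G.Act i j → ℝ := fun a =>
    ∑ j' : G.Info i with InfoLESeq j' (seqI j), ∑ a' : G.Act i j',
      lam ⟨j', a'⟩ * y ⟨j', a'⟩ (some ⟨j, a⟩) * x (some ⟨j', a'⟩)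
  let W : Matrix (G.Act i j) (G.Act i j) ℝ := fun ar ac =>
    r ar + (lam ⟨j, ac⟩ * y ⟨j, ac⟩ (some ⟨j, ar⟩)
      + (1 - ∑ τ : G.Trig i with TrigLE τ (some ⟨j, ac⟩), lam τ) * (if ar = ac then 1 else 0)) * xp
  let w : G.Act i j → ℝ := if xp = 0 then 0 else xp • F j (xp⁻¹ • W)
  fun σ =>
    match σ with
    | none => x none
    | some ⟨j', a'⟩ => if h : j' = j then w (h ▸ a') else x (some ⟨j', a'⟩)

/-- The algorithm FixedPoint: the information sets are treated in the given order, starting from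
the vector that is `1` at the empty sequence and `0` elsewhere. -/
noncomputable def fixedPoint
    (F : (j : G.Info i) → Matrix (G.Act i j) (G.Act i j) ℝ → G.Act i j → ℝ)
    (order : List (G.Info i)) (lam : G.Trig i → ℝ) (y : G.Trig i → G.Seq i → ℝ) : G.Seq i → ℝ :=
  order.foldl (extend F lam y) (Pi.single none 1)

/-- A top-down enumeration of the information sets of a player. -/
def IsTopDown (order : List (G.Info i)) : Prop :=
  order.Nodup ∧ (∀ j, j ∈ order) ∧ order.Pairwise (fun j j' => ¬ InfoLT j' j)

/-! ## The learning dynamics -/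

variable (G) in
/-- The parameters of the algorithm of player `i`: a rule for the simplex over the trigger
sequences, for each trigger sequence `(j, a)` a rule for `QSub j`, the oracle for fixed points
of stochastic matrices, and the order in which the information sets are visited. -/
structure Params (i : Fin n) where
  simplexRule : OnlineRule (G.Trig i)
  contRule : G.Trig i → OnlineRule (G.Seq i)
  oracle : (j : G.Info i) → Matrix (G.Act i j) (G.Act i j) ℝ → G.Act i j → ℝ
  order : List (G.Info i)

namespace Params

/-- The fixed-point oracle and the enumeration of the information sets are correct. -/
def Admissible (A : G.Params i) : Prop :=
  (∀ j, IsFixedPointOracle (A.oracle j)) ∧ IsTopDown A.order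

/-- The local rules are regret minimizers for the simplex and for the sets `QSub j`. -/
def NoRegret (A : G.Params i) : Prop :=
  IsRegretMinimizer (stdSimplex ℝ (G.Trig i)) A.simplexRule ∧
  ∀ τ : G.Trig i, IsRegretMinimizer (QSub τ.1) (A.contRule τ)

/-- The local rules are regret matching and CFR. -/
def UsesCFR (A : G.Params i) : Prop :=
  A.simplexRule = regretMatching ∧ ∀ τ : G.Trig i, A.contRule τ = cfr τ.1

variable (G i) in
/-- The state of the algorithm: the utility vectors passed so far to the rule for the simplex and to
the rule of each trigger sequence. -/
abbrev State : Type := List (G.Trig i → ℝ) × (G.Trig i → List (G.Seq i → ℝ))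

/-- The weights of the trigger sequences in the next transformation. -/
def weights (A : G.Params i) (s : State G i) : G.Trig i → ℝ := A.simplexRule s.1

/-- The continuation strategies in the next transformation. -/
def conts (A : G.Params i) (s : State G i) : G.Trig i → G.Seq i → ℝ := fun τ => A.contRule τ (s.2 τ)

/-- NextElement, for mixed strategies: a fixed point of the next transformation. -/
noncomputable def nextMixed (A : G.Params i) (s : State G i) : G.Seq i → ℝ :=
  fixedPoint A.oracle A.order (A.weights s) (A.conts s)

/-- ObserveUtility: on observing `ℓ`, the linear functional `L : M ↦ ℓ (M q)` on matrices, where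
`q` is the last output, is formed; the rule of the trigger sequence `τ` observes the linear function
`x ↦ L (devMatrix τ x) - L (devMatrix τ 0)`, and the rule for the simplex observes
`lam ↦ ∑ τ, lam τ * L (devMatrix τ (y τ))`, where `y` are the last continuation strategies. -/
noncomputable def observe (A : G.Params i) (s : State G i) (ℓ : G.Seq i → ℝ) : State G i :=
  let q := A.nextMixed s
  let L : Matrix (G.Seq i) (G.Seq i) ℝ → ℝ := fun M => ℓ ⬝ᵥ M.mulVec q
  (s.1 ++ [fun τ => L (devMatrix τ (A.conts s τ))],
   fun τ => s.2 τ ++ [fun σ => L (devMatrix τ (Pi.single σ 1)) - L (devMatrix τ 0)])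

/-- The mixed strategy computed after the utility vectors in `hist` have been observed. -/
noncomputable def mixed (A : G.Params i) (hist : List (G.Seq i → ℝ)) : G.Seq i → ℝ :=
  A.nextMixed (hist.foldl A.observe ([], fun _ => []))

end Params

open Classical in
/-- The linear utility function of player `i` when the others play according to `π`, as a vector:
`x ↦ ∑ z, u z * pc z * (∏ i' ≠ i, π i' (σ i' z)) * x (σ i z)`. -/
noncomputable def utility (i : Fin n) (π : G.Profile) : G.Seq i → ℝ := fun σ =>
  ∑ z : G.Z with G.seqZ i z = σ,
    G.tree.payoff z i * G.tree.chanceProb z *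
      ∏ i' ∈ Finset.univ.erase i, (π i').1 (G.seqZ i' z)

open Classical in
/-- The probability that the natural sampling scheme, applied to the mixed strategy `q`, returns
the deterministic strategy `π`: at each information set `j` that is visited, the action `a` is drawn
with probability `q (j, a) / q (σ j)`. -/
noncomputable def sampleProb (q : G.Seq i → ℝ) (π : G.Pure i) : ℝ :=
  ∏ τ : G.Trig i with π.1 (some τ) = 1, q (some τ) / q (seqI τ.1)

/-- The random profiles `π 0, π 1, …` are those of the repeated game in which each player `i` uses
the algorithm with parameters `A i`: given the profiles of the first `t` repetitions, the players
independently sample their next strategies, player `i` from the mixed strategy that the algorithm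
computes from the utility functions observed so far. -/
def IsPlay {Ω : Type*} [MeasurableSpace Ω] (P : Measure Ω) (A : (i : Fin n) → G.Params i)
    (π : ℕ → Ω → G.Profile) : Prop :=
  (∀ t p, MeasurableSet {ω | π t ω = p}) ∧
  ∀ (t : ℕ) (h : List G.Profile) (p : G.Profile),
    P.real {ω | (List.range t).map (fun s => π s ω) = h ∧ π t ω = p}
      = P.real {ω | (List.range t).map (fun s => π s ω) = h} *
        ∏ i, sampleProb ((A i).mixed (h.map (utility i))) (p i)

open Classical in
/-- The empirical frequency of play of the first `T` repetitions. -/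
noncomputable def empirical (π : ℕ → G.Profile) (T : ℕ) : G.Profile → ℝ := fun p =>
  (1 / (T : ℝ)) * ∑ t ∈ Finset.range T, if π t = p then 1 else 0

end ExtensiveGame

/-!
The empirical frequency of play converges to the set of extensive-form correlated equilibria because
no player gains asymptotically from a trigger deviation. For a trigger sequence `τ = (j, a)` and a
continuation strategy `ρ`, the two sides of the equilibrium condition differ by the expectation of
`gain τ ρ`, the change of the player's utility when `devMatrix τ ρ` is applied to the recommended
strategy (`isApproxEFCE_iff`). Hence it suffices that the average gain of the sampled strategies is
asymptotically nonpositive for each of the finitely many deviations; compactness of the simplex of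
distributions turns this into convergence, and shows that equilibria exist
(`tendsto_infEDist_of_eventually_le`).

The average gain is controlled in two steps.

* The mixed strategy `q` that the algorithm computes is a sequence-form strategy and a fixed point
  of the current transformation `φ = ∑ τ, lam τ • devMatrix τ (y τ)` (`fixedPoint_spec`). At each
  information set the fixed-point equation for the parent sequence makes the local matrix
  column-stochastic, and later steps do not disturb the rows that have been treated. As `φ q = q`,
  the regret with respect to `devMatrix τ ρ` is the regret of the rule for the simplex against `τ`
  plus the regret of the rule of `τ` against `ρ`, so it is sublinear
  (`Params.NoRegret.eventually_trigger_regret_le`). Regret matching is a regret minimizer by the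
  quadratic potential of the positive parts of the regrets, and CFR is one by the
  performance-difference identity `sub_toSeqForm_apply`, which bounds the regret by the local
  counterfactual regrets.
* Sampling amounts to drawing an action at every information set independently, so that the sampled
  strategy has mean `q` (`sum_sampleProb_mul`). As the players sample independently, the gain of the
  sampled strategy minus the gain of `q` is a bounded martingale difference
  (`sum_prod_sampleProb_mul_gain_sub`), and its averages vanish almost surely by an elementary
  strong law of large numbers (`ae_tendsto_average_of_transition`).
-/

/-! ### Regret matching -/

section RegretMatching

variable {ι : Type} [Fintype ι]

theorem regretMatch_mem_stdSimplex [Nonempty ι] (r : ι → ℝ) :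
    regretMatch r ∈ stdSimplex ℝ ι := by
  unfold regretMatch
  split_ifs with h
  · refine ⟨fun a => by positivity, ?_⟩
    simp
  · have hs : 0 ≤ ∑ b, max (r b) 0 := Finset.sum_nonneg fun b _ => le_max_right _ _
    refine ⟨fun a => div_nonneg (le_max_right _ _) hs, ?_⟩
    rw [← Finset.sum_div, div_self h]

theorem sum_posPart_mul_eq_zero {r v : ι → ℝ} (h : ∑ a, regretMatch r a * v a = 0) :
    ∑ a, max (r a) 0 * v a = 0 := by
  by_cases hs : ∑ b, max (r b) 0 = 0
  · have h0 := (Finset.sum_eq_zero_iff_of_nonneg fun b _ => le_max_right (r b) 0).1 hs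
    exact Finset.sum_eq_zero fun a ha => by rw [h0 a ha, zero_mul]
  · simp only [regretMatch, if_neg hs, div_mul_eq_mul_div] at h
    rwa [← Finset.sum_div, div_eq_zero_iff, or_iff_left hs] at h

theorem sq_max_add_le (r v : ℝ) :
    max (r + v) 0 ^ 2 ≤ max r 0 ^ 2 + 2 * (max r 0 * v) + v ^ 2 := by
  rcases le_total (r + v) 0 with h | h
  · rw [max_eq_right h]
    nlinarith [sq_nonneg (max r 0 + v)]
  · rw [max_eq_left h]
    nlinarith [le_max_left r 0]

/-- The potential argument behind regret matching: if every increment `v t` of the cumulative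
regrets `R t` is orthogonal to the regret-matching distribution of `R t`, then the sum of the
squares of the positive parts of the regrets grows at most linearly. -/
theorem sum_sq_posPart_le {R v : ℕ → ι → ℝ} (h0 : R 0 = 0)
    (hs : ∀ t a, R (t + 1) a = R t a + v t a)
    (hv : ∀ t, ∑ a, regretMatch (R t) a * v t a = 0) {C : ℝ} (hC : ∀ t a, |v t a| ≤ C) (T : ℕ) :
    ∑ a, max (R T a) 0 ^ 2 ≤ T * (Fintype.card ι * C ^ 2) := by
  induction T with
  | zero => simp [h0]
  | succ T ih =>
    calc ∑ a, max (R (T + 1) a) 0 ^ 2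
        ≤ ∑ a, (max (R T a) 0 ^ 2 + 2 * (max (R T a) 0 * v T a) + C ^ 2) := by
          refine Finset.sum_le_sum fun a _ => ?_
          rw [hs]
          have := sq_le_sq' (abs_le.1 (hC T a)).1 (abs_le.1 (hC T a)).2
          linarith [sq_max_add_le (R T a) (v T a)]
      _ = ∑ a, max (R T a) 0 ^ 2 + Fintype.card ι * C ^ 2 := by
          simp only [Finset.sum_add_distrib, ← Finset.mul_sum, sum_posPart_mul_eq_zero (hv T)]
          simp
      _ ≤ _ := by push_cast; linarith

theorem eventually_regret_le {R v : ℕ → ι → ℝ} (h0 : R 0 = 0)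
    (hs : ∀ t a, R (t + 1) a = R t a + v t a)
    (hv : ∀ t, ∑ a, regretMatch (R t) a * v t a = 0) {C : ℝ} (hC : ∀ t a, |v t a| ≤ C)
    {ε : ℝ} (hε : 0 < ε) : ∀ᶠ T : ℕ in atTop, ∀ a, R T a ≤ ε * T := by
  obtain ⟨N, hN⟩ := exists_nat_ge (Fintype.card ι * C ^ 2 / ε ^ 2)
  filter_upwards [eventually_ge_atTop N] with T hT a
  have h1 := sum_sq_posPart_le h0 hs hv hC T
  have h2 : max (R T a) 0 ^ 2 ≤ ∑ a, max (R T a) 0 ^ 2 :=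
    Finset.single_le_sum (f := fun a => max (R T a) 0 ^ 2) (fun _ _ => sq_nonneg _)
      (Finset.mem_univ a)
  have h3 : Fintype.card ι * C ^ 2 ≤ T * ε ^ 2 := by
    rw [← div_le_iff₀ (by positivity)]
    exact hN.trans (by exact_mod_cast hT)
  have h4 : max (R T a) 0 ^ 2 ≤ (ε * T) ^ 2 := by
    have : (T : ℝ) * (Fintype.card ι * C ^ 2) ≤ T * (T * ε ^ 2) := by gcongr
    nlinarith
  exact (le_max_left _ _).trans (abs_le_of_sq_le_sq' h4 (by positivity)).2

theorem abs_dotProduct_le_mul {g x : ι → ℝ} {B C : ℝ} (hg : ∀ a, |g a| ≤ B)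
    (hx : ∀ a, |x a| ≤ C) : |g ⬝ᵥ x| ≤ Fintype.card ι * (B * C) := by
  calc |g ⬝ᵥ x| ≤ ∑ a, |g a * x a| := Finset.abs_sum_le_sum_abs _ _
    _ ≤ ∑ _a : ι, B * C := by
        refine Finset.sum_le_sum fun a _ => ?_
        rw [abs_mul]
        exact mul_le_mul (hg a) (hx a) (abs_nonneg _) ((abs_nonneg _).trans (hg a))
    _ = _ := by simp

theorem abs_dotProduct_le {g x : ι → ℝ} {B : ℝ} (hg : ∀ a, |g a| ≤ B) (hx : ∀ a, |x a| ≤ 1) :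
    |g ⬝ᵥ x| ≤ Fintype.card ι * B := by
  simpa using abs_dotProduct_le_mul hg hx

theorem abs_le_one_of_mem_stdSimplex {x : ι → ℝ} (hx : x ∈ stdSimplex ℝ ι) (a : ι) :
    |x a| ≤ 1 := by
  rw [abs_of_nonneg (hx.1 a), ← hx.2]
  exact Finset.single_le_sum (fun b _ => hx.1 b) (Finset.mem_univ a)

theorem isRegretMinimizer_regretMatching :
    IsRegretMinimizer (stdSimplex ℝ ι) (regretMatching : OnlineRule ι) := by
  rintro ⟨x₀, hx₀⟩
  have : Nonempty ι := by
    by_contra h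
    rw [not_nonempty_iff] at h
    simpa using hx₀.2
  refine ⟨fun hist => regretMatch_mem_stdSimplex _, ?_⟩
  rintro ℓ ⟨B, hB⟩ ε hε
  set R : ℕ → ι → ℝ := fun t => ((List.range t).map ℓ).foldl
    (fun r ℓ a => r a + (ℓ a - ℓ ⬝ᵥ regretMatch r)) 0 with hR
  set v : ℕ → ι → ℝ := fun t a => ℓ t a - ℓ t ⬝ᵥ regretMatch (R t) with hv
  have hs : ∀ t a, R (t + 1) a = R t a + v t a := by
    intro t a
    simp [hR, hv, List.range_succ]
  have horth : ∀ t, ∑ a, regretMatch (R t) a * v t a = 0 := by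
    intro t
    simp only [hv, mul_sub, Finset.sum_sub_distrib, ← Finset.sum_mul,
      (regretMatch_mem_stdSimplex (R t)).2, one_mul]
    rw [sub_eq_zero, dotProduct]
    exact Finset.sum_congr rfl fun a _ => mul_comm _ _
  have hC : ∀ t a, |v t a| ≤ B + Fintype.card ι * B := fun t a =>
    (abs_sub _ _).trans (add_le_add (hB t a) (abs_dotProduct_le (hB t)
      (abs_le_one_of_mem_stdSimplex (regretMatch_mem_stdSimplex _))))
  filter_upwards [eventually_regret_le (R := R) (by simp [hR]) hs horth hC hε] with T hT x hx
  have hsum : ∀ a, ∑ t ∈ Finset.range T, v t a = R T a := by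
    intro a
    rw [Finset.sum_congr rfl fun t _ => eq_sub_of_add_eq' (hs t a).symm,
      Finset.sum_range_sub (fun t => R t a)]
    simp [hR]
  calc ∑ t ∈ Finset.range T, (ℓ t ⬝ᵥ x - ℓ t ⬝ᵥ regretMatching ((List.range t).map ℓ))
      = ∑ t ∈ Finset.range T, ∑ a, x a * v t a := by
        refine Finset.sum_congr rfl fun t _ => ?_
        simp only [hv, mul_sub, Finset.sum_sub_distrib, ← Finset.sum_mul, hx.2, one_mul]
        congr 1
        exact Finset.sum_congr rfl fun a _ => mul_comm _ _
    _ = ∑ a, x a * R T a := by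
        rw [Finset.sum_comm]
        simp only [← Finset.mul_sum, hsum]
    _ ≤ ∑ a, x a * (ε * T) :=
        Finset.sum_le_sum fun a _ => mul_le_mul_of_nonneg_left (hT a) (hx.1 a)
    _ = ε * T := by rw [← Finset.sum_mul, hx.2, one_mul]

end RegretMatching

/-! ### A strong law of large numbers for bounded martingale differences -/

/-- The averages of a bounded sequence converge to zero if they do so along the squares. -/
theorem tendsto_average_of_tendsto_sq {d : ℕ → ℝ} {C : ℝ} (hd : ∀ t, |d t| ≤ C)
    (h : Tendsto (fun k : ℕ => (∑ t ∈ Finset.range (k ^ 2), d t) / (k : ℝ) ^ 2) atTop (𝓝 0)) :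
    Tendsto (fun T : ℕ => (∑ t ∈ Finset.range T, d t) / T) atTop (𝓝 0) := by
  have hsqrt : Tendsto Nat.sqrt atTop atTop :=
    tendsto_atTop_atTop.2 fun b => ⟨b * b, fun a ha => Nat.le_sqrt.2 ha⟩
  have hC : 0 ≤ C := (abs_nonneg _).trans (hd 0)
  have h1 : Tendsto (fun k : ℕ => |(∑ t ∈ Finset.range (k ^ 2), d t) / (k : ℝ) ^ 2| + 2 * C / k)
      atTop (𝓝 0) := by
    simpa using h.abs.add (tendsto_const_div_atTop_nhds_zero_nat (2 * C))
  refine squeeze_zero_norm' ?_ (h1.comp hsqrt)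
  filter_upwards [eventually_ge_atTop 1] with T hT
  set k := Nat.sqrt T with hk
  have hk1 : 1 ≤ k := Nat.le_sqrt.2 (by simpa using hT)
  have hk2 : k ^ 2 ≤ T := Nat.sqrt_le' T
  have hk3 : T ≤ k ^ 2 + 2 * k := by have := Nat.sqrt_le_add T; rw [← hk] at this; nlinarith
  have hk0 : (0 : ℝ) < k := by exact_mod_cast hk1
  have hsum : |∑ t ∈ Finset.range T, d t| ≤ |∑ t ∈ Finset.range (k ^ 2), d t| + 2 * k * C := by
    rw [← Finset.sum_range_add_sum_Ico d hk2]
    refine (abs_add_le _ _).trans (add_le_add le_rfl ?_)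
    calc |∑ t ∈ Finset.Ico (k ^ 2) T, d t| ≤ ∑ t ∈ Finset.Ico (k ^ 2) T, |d t| :=
          Finset.abs_sum_le_sum_abs _ _
      _ ≤ ∑ _t ∈ Finset.Ico (k ^ 2) T, C := Finset.sum_le_sum fun t _ => hd t
      _ = ((T - k ^ 2 : ℕ) : ℝ) * C := by simp
      _ ≤ 2 * k * C := by
          refine mul_le_mul_of_nonneg_right ?_ hC
          have : T - k ^ 2 ≤ 2 * k := by omega
          exact_mod_cast this
  have hT2 : (k : ℝ) ^ 2 ≤ T := by exact_mod_cast hk2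
  have hT0 : (0 : ℝ) < T := lt_of_lt_of_le (by positivity) hT2
  rw [Real.norm_eq_abs, abs_div, Function.comp_apply, abs_div, abs_of_pos hT0,
    abs_of_pos (show (0 : ℝ) < (k : ℝ) ^ 2 by positivity)]
  calc |∑ t ∈ Finset.range T, d t| / T
      ≤ (|∑ t ∈ Finset.range (k ^ 2), d t| + 2 * k * C) / (k : ℝ) ^ 2 := by gcongr
    _ = |∑ t ∈ Finset.range (k ^ 2), d t| / (k : ℝ) ^ 2 + 2 * C / k := by
        rw [add_div]
        congr 1
        field_simp

section StrongLaw

variable {Ω : Type*} [MeasurableSpace Ω] {P : Measure Ω} [IsProbabilityMeasure P]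

theorem integrable_of_measurable_of_abs_le {f : Ω → ℝ} (hf : Measurable f) {C : ℝ}
    (h : ∀ ω, |f ω| ≤ C) : Integrable f P :=
  Integrable.of_bound hf.aestronglyMeasurable C (Eventually.of_forall h)

theorem abs_sum_range_le {d : ℕ → ℝ} {C : ℝ} (hd : ∀ t, |d t| ≤ C) (T : ℕ) :
    |∑ t ∈ Finset.range T, d t| ≤ T * C := by
  refine (Finset.abs_sum_le_sum_abs _ _).trans ((Finset.sum_le_sum fun t _ => hd t).trans_eq ?_)
  simp

/-- The second moment of a sum of orthogonal variables, at most `C` in absolute value, grows at most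
linearly. -/
theorem integral_sq_sum_le {d : ℕ → Ω → ℝ} (hm : ∀ t, Measurable (d t)) {C : ℝ}
    (hC : ∀ t ω, |d t ω| ≤ C) (horth : ∀ s t, s < t → ∫ ω, d s ω * d t ω ∂P = 0) (T : ℕ) :
    ∫ ω, (∑ t ∈ Finset.range T, d t ω) ^ 2 ∂P ≤ T * C ^ 2 := by
  have hint : ∀ s t, Integrable (fun ω => d s ω * d t ω) P := fun s t =>
    integrable_of_measurable_of_abs_le ((hm s).mul (hm t)) (C := C * C) fun ω => by
      rw [abs_mul]
      exact mul_le_mul (hC s ω) (hC t ω) (abs_nonneg _) ((abs_nonneg _).trans (hC s ω))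
  have hintS : ∀ T t, Integrable (fun ω => (∑ s ∈ Finset.range T, d s ω) * d t ω) P := by
    intro T t
    simp only [Finset.sum_mul]
    exact integrable_finsetSum _ fun s _ => hint s t
  have hintSS : ∀ T, Integrable (fun ω => (∑ s ∈ Finset.range T, d s ω) ^ 2) P := by
    intro T
    simp only [sq]
    conv => enter [1, ω]; rw [Finset.mul_sum]
    exact integrable_finsetSum _ fun s _ => hintS T s
  induction T with
  | zero => simp
  | succ T ih =>
    have hcross : ∫ ω, (∑ s ∈ Finset.range T, d s ω) * d T ω ∂P = 0 := by
      simp only [Finset.sum_mul]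
      rw [integral_finsetSum _ fun s _ => hint s T]
      exact Finset.sum_eq_zero fun s hs => horth s T (Finset.mem_range.1 hs)
    have hsq : ∫ ω, d T ω * d T ω ∂P ≤ C ^ 2 := by
      calc ∫ ω, d T ω * d T ω ∂P ≤ ∫ _ω, C ^ 2 ∂P := by
            refine integral_mono (hint T T) (integrable_const _) fun ω => ?_
            change d T ω * d T ω ≤ C ^ 2
            rw [← sq]
            exact sq_le_sq' (abs_le.1 (hC T ω)).1 (abs_le.1 (hC T ω)).2
        _ = C ^ 2 := by simp
    have hexp : ∀ ω, (∑ t ∈ Finset.range (T + 1), d t ω) ^ 2 =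
        (∑ t ∈ Finset.range T, d t ω) ^ 2 + 2 * ((∑ t ∈ Finset.range T, d t ω) * d T ω)
          + d T ω * d T ω := by
      intro ω
      rw [Finset.sum_range_succ]
      ring
    simp only [hexp]
    have hi := (hintS T T).const_mul 2
    have hadd : Integrable (fun ω => (∑ t ∈ Finset.range T, d t ω) ^ 2
        + 2 * ((∑ t ∈ Finset.range T, d t ω) * d T ω)) P := (hintSS T).add hi
    rw [integral_add hadd (hint T T), integral_add (hintSS T) hi, integral_const_mul, hcross]
    push_cast
    linarith

/-- The averages of bounded, pairwise orthogonal random variables converge to zero almost surely: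
along the squares by Chebyshev's argument, hence along all integers. -/
theorem ae_tendsto_average_of_orthogonal {d : ℕ → Ω → ℝ} (hm : ∀ t, Measurable (d t)) {C : ℝ}
    (hC : ∀ t ω, |d t ω| ≤ C) (horth : ∀ s t, s < t → ∫ ω, d s ω * d t ω ∂P = 0) :
    ∀ᵐ ω ∂P, Tendsto (fun T : ℕ => (∑ t ∈ Finset.range T, d t ω) / T) atTop (𝓝 0) := by
  set Y : ℕ → Ω → ℝ := fun k ω =>
    ((∑ t ∈ Finset.range ((k + 1) ^ 2), d t ω) / ((k + 1 : ℕ) : ℝ) ^ 2) ^ 2 with hY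
  have hYm : ∀ k, Measurable (Y k) := fun k =>
    ((Finset.measurable_sum _ fun t _ => hm t).div_const _).pow_const 2
  have hY0 : ∀ k ω, 0 ≤ Y k ω := fun k ω => sq_nonneg _
  have hYi : ∀ k, Integrable (Y k) P := by
    intro k
    refine integrable_of_measurable_of_abs_le (hYm k) (C := C ^ 2) fun ω => ?_
    have hk : (0 : ℝ) < ((k + 1 : ℕ) : ℝ) ^ 2 := by positivity
    rw [abs_of_nonneg (hY0 k ω)]
    refine sq_le_sq' ?_ ?_ <;>
    have hb := abs_le.1 (abs_sum_range_le (fun t => hC t ω) ((k + 1) ^ 2)) <;>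
    rw [Nat.cast_pow] at hb
    · rw [le_div_iff₀ hk]; linarith [hb.1]
    · rw [div_le_iff₀ hk]; linarith [hb.2]
  have hYb : ∀ k, ∫ ω, Y k ω ∂P ≤ C ^ 2 * (1 / ((k + 1 : ℕ) : ℝ) ^ 2) := by
    intro k
    have hk : (0 : ℝ) < ((k + 1 : ℕ) : ℝ) ^ 2 := by positivity
    simp only [hY, div_pow]
    rw [integral_div, div_le_iff₀ (by positivity)]
    refine (integral_sq_sum_le hm hC horth ((k + 1) ^ 2)).trans_eq ?_
    rw [Nat.cast_pow]
    field_simp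
  have hsummable : Summable fun k : ℕ => C ^ 2 * (1 / ((k + 1 : ℕ) : ℝ) ^ 2) :=
    ((summable_nat_add_iff 1).2 (Real.summable_one_div_nat_pow.2 one_lt_two)).mul_left _
  have hfin : ∫⁻ ω, ∑' k, ENNReal.ofReal (Y k ω) ∂P ≠ ⊤ := by
    rw [lintegral_tsum fun k => (hYm k).ennreal_ofReal.aemeasurable]
    refine ne_top_of_le_ne_top hsummable.tsum_ofReal_ne_top (ENNReal.tsum_le_tsum fun k => ?_)
    rw [← ofReal_integral_eq_lintegral_ofReal (hYi k) (Eventually.of_forall (hY0 k))]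
    exact ENNReal.ofReal_le_ofReal (hYb k)
  filter_upwards [ae_lt_top (Measurable.tsum fun k => (hYm k).ennreal_ofReal) hfin]
    with ω hω
  refine tendsto_average_of_tendsto_sq (fun t => hC t ω) ?_
  rw [← tendsto_add_atTop_iff_nat 1]
  have h1 := ENNReal.tendsto_atTop_zero_of_tsum_ne_top hω.ne
  have h2 : Tendsto (fun k => Y k ω) atTop (𝓝 0) := by
    have h := (ENNReal.tendsto_toReal ENNReal.zero_ne_top).comp h1
    simp only [Function.comp_def, ENNReal.toReal_zero] at h
    exact h.congr fun k => ENNReal.toReal_ofReal (hY0 k ω)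
  have h3 := h2.sqrt
  rw [Real.sqrt_zero] at h3
  simp only [hY, Real.sqrt_sq_eq_abs] at h3
  exact (tendsto_zero_iff_abs_tendsto_zero _).2 h3

theorem integral_comp_eq_sum {α : Type*} [Fintype α] {Y : Ω → α}
    (hY : ∀ x, MeasurableSet {ω | Y ω = x}) (g : α → ℝ) :
    ∫ ω, g (Y ω) ∂P = ∑ x, P.real {ω | Y ω = x} * g x := by
  classical
  have h : ∀ ω, g (Y ω) = ∑ x, Set.indicator {ω | Y ω = x} (fun _ => g x) ω := by
    intro ω
    simp [Set.indicator_apply]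
  simp only [h]
  rw [integral_finsetSum _ fun x _ => (integrable_const (g x)).indicator (hY x)]
  refine Finset.sum_congr rfl fun x _ => ?_
  rw [integral_indicator_const _ (hY x), smul_eq_mul]

theorem measurable_comp_of_finite {α : Type*} [Fintype α] {Y : Ω → α}
    (hY : ∀ x, MeasurableSet {ω | Y ω = x}) (g : α → ℝ) : Measurable fun ω => g (Y ω) := by
  intro s _
  have : (fun ω => g (Y ω)) ⁻¹' s = ⋃ x ∈ {x | g x ∈ s}, {ω | Y ω = x} := by
    ext ω
    simp
  rw [this]
  exact MeasurableSet.biUnion (Set.to_countable _) fun x _ => hY x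

/-- The strong law for a process with finitely many values and transition probabilities `K`: the
averages of bounded functions `D` of the past and the present converge to zero if these functions
have conditional expectation zero given the past. -/
theorem ae_tendsto_average_of_transition {S : Type*} [Fintype S] {X : ℕ → Ω → S}
    (hX : ∀ t s, MeasurableSet {ω | X t ω = s}) {K : List S → S → ℝ}
    (hK : ∀ t h s, P.real {ω | (List.range t).map (fun r => X r ω) = h ∧ X t ω = s} =
      P.real {ω | (List.range t).map (fun r => X r ω) = h} * K h s)
    {D : List S → S → ℝ} {C : ℝ} (hD : ∀ h s, |D h s| ≤ C)
    (h0 : ∀ h, ∑ s, K h s * D h s = 0) :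
    ∀ᵐ ω ∂P, Tendsto (fun T : ℕ => (∑ t ∈ Finset.range T,
      D ((List.range t).map (fun r => X r ω)) (X t ω)) / T) atTop (𝓝 0) := by
  have hlist : ∀ t ω, (List.range t).map (fun r => X r ω) =
      List.ofFn (fun r : Fin t => X r ω) := by
    intro t ω
    rw [List.ofFn_eq_map, ← List.map_coe_finRange_eq_range, List.map_map]
    rfl
  have hmeas : ∀ t (x : (Fin t → S) × S),
      MeasurableSet {ω | ((fun r : Fin t => X r ω), X t ω) = x} := by
    rintro t ⟨y, s⟩
    have : {ω | ((fun r : Fin t => X r ω), X t ω) = (y, s)} =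
        (⋂ r : Fin t, {ω | X (r : ℕ) ω = y r}) ∩ {ω | X t ω = s} := by
      ext ω
      simp [funext_iff]
    rw [this]
    exact (MeasurableSet.iInter fun r : Fin t => hX r (y r)).inter (hX t s)
  refine ae_tendsto_average_of_orthogonal (C := C) (fun t => ?_) (fun t ω => hD _ _) ?_
  · simp only [hlist]
    exact measurable_comp_of_finite (hmeas t) fun x => D (List.ofFn x.1) x.2
  · intro s t hst
    simp only [hlist]
    refine (integral_comp_eq_sum (hmeas t) fun x =>
      D (List.ofFn fun r : Fin s => x.1 (Fin.castLE hst.le r)) (x.1 ⟨s, hst⟩)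
        * D (List.ofFn x.1) x.2).trans ?_
    rw [Fintype.sum_prod_type]
    refine Finset.sum_eq_zero fun y _ => ?_
    have hprob : ∀ x, P.real {ω | ((fun r : Fin t => X r ω), X t ω) = (y, x)} =
        P.real {ω | (List.range t).map (fun r => X r ω) = List.ofFn y} * K (List.ofFn y) x := by
      intro x
      rw [← hK]
      congr 1
      ext ω
      simp [hlist, List.ofFn_inj]
    simp only [hprob]
    have := h0 (List.ofFn y)
    calc _ = P.real {ω | (List.range t).map (fun r => X r ω) = List.ofFn y} *
          D (List.ofFn fun r : Fin s => y (Fin.castLE hst.le r)) (y ⟨s, hst⟩) *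
          ∑ x, K (List.ofFn y) x * D (List.ofFn y) x := by
          rw [Finset.mul_sum]
          exact Finset.sum_congr rfl fun x _ => by ring
      _ = 0 := by rw [this, mul_zero]

end StrongLaw

/-! ### Perfect recall and the order of information sets -/

namespace GameTree

variable {n : ℕ} {Info : Fin n → Type} {Act : (i : Fin n) → Info i → Type}

/-- The last own move of player `i` before a node was made at an earlier node, at which the
player's past consisted of the remaining own moves. -/
theorem IsNode.exists_of_own_eq_cons {T S : GameTree Info Act} {p : List (Move Info Act)}
    (h : T.IsNode p S) {i : Fin n} {τ : (j : Info i) × Act i j}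
    {l : List ((j : Info i) × Act i j)} (e : own i p = τ :: l) :
    ∃ p' next, T.IsNode p' (.decision i τ.1 next) ∧ own i p' = l := by
  induction h with
  | root => simp [own] at e
  | chance _ _ ih => exact ih e
  | @decision p i' j next h a ih =>
    by_cases hi : i' = i
    · subst hi
      simp only [own, moveOf, List.filterMap_cons, dite_true, List.cons.injEq] at e
      obtain ⟨rfl, rfl⟩ := e
      exact ⟨p, next, h, rfl⟩
    · refine ih ?_
      simpa only [own, moveOf, List.filterMap_cons, dif_neg hi] using e

end GameTree

namespace ExtensiveGame

variable {n : ℕ} {G : ExtensiveGame n} {i : Fin n}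

theorem past_eq_of_seqI_eq_some {j : G.Info i} {τ : G.Trig i} (h : seqI j = some τ) :
    G.past i j = τ :: G.past i τ.1 := by
  obtain ⟨l, hl⟩ : ∃ l, G.past i j = τ :: l := by
    cases hp : G.past i j with
    | nil => simp [seqI, hp] at h
    | cons a l => exact ⟨l, by simpa [seqI, hp] using h⟩
  obtain ⟨p, next, hp⟩ := G.info_nonempty i j
  obtain ⟨p', next', hp', e⟩ :=
    hp.exists_of_own_eq_cons ((G.perfect_recall i j p next hp).trans hl)
  rw [hl, ← e, G.perfect_recall i τ.1 p' next' hp']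

theorem past_eq_nil_of_seqI_eq_none {j : G.Info i} (h : seqI j = none) : G.past i j = [] := by
  simpa [seqI] using h

/-- Induction along the path to an information set, through the player's own moves. -/
theorem seqI_induction {p : G.Info i → Prop} (root : ∀ j, seqI j = none → p j)
    (step : ∀ j τ, seqI j = some τ → p τ.1 → p j) (j : G.Info i) : p j := by
  induction hl : (G.past i j).length using Nat.strong_induction_on generalizing j with
  | _ k ih =>
    cases h : seqI j with
    | none => exact root j h
    | some τ =>
      refine step j τ h (ih _ ?_ τ.1 rfl)
      rw [← hl, past_eq_of_seqI_eq_some h]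
      simp

theorem trigLE_some {τ τ' : G.Trig i} : TrigLE τ (some τ') ↔ τ = τ' ∨ τ ∈ G.past i τ'.1 := by
  simp [TrigLE]

theorem not_trigLE_none {τ : G.Trig i} : ¬ TrigLE τ none := by
  simp [TrigLE]

theorem infoLESeq_some {j : G.Info i} {τ : G.Trig i} : InfoLESeq j (some τ) ↔ InfoLE j τ.1 := by
  simp [InfoLESeq]

theorem not_infoLESeq_none {j : G.Info i} : ¬ InfoLESeq j none := by
  simp [InfoLESeq]

theorem trigLE_seqI {τ : G.Trig i} {j : G.Info i} : TrigLE τ (seqI j) ↔ τ ∈ G.past i j := by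
  cases h : seqI j with
  | none => simp [not_trigLE_none, past_eq_nil_of_seqI_eq_none h]
  | some τ' => rw [trigLE_some, past_eq_of_seqI_eq_some h, List.mem_cons]

theorem infoLESeq_seqI {j' j : G.Info i} : InfoLESeq j' (seqI j) ↔ InfoLT j' j := by
  cases h : seqI j with
  | none => simp [not_infoLESeq_none, InfoLT, past_eq_nil_of_seqI_eq_none h]
  | some τ =>
    rw [infoLESeq_some, InfoLE, InfoLT, InfoLT, past_eq_of_seqI_eq_some h]
    obtain ⟨j₁, a₁⟩ := τ
    constructor
    · rintro (rfl | ⟨a, ha⟩)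
      · exact ⟨a₁, by simp⟩
      · exact ⟨a, by simp [ha]⟩
    · rintro ⟨a, ha⟩
      rcases List.mem_cons.1 ha with ha | ha
      · exact Or.inl (congrArg Sigma.fst ha)
      · exact Or.inr ⟨a, ha⟩

theorem infoLT_of_seqI_eq_some {j : G.Info i} {τ : G.Trig i} (h : seqI j = some τ) :
    InfoLT τ.1 j := by
  rw [← infoLESeq_seqI, h, infoLESeq_some]
  exact Or.inl rfl

theorem InfoLT.length_lt {j' j : G.Info i} (h : InfoLT j' j) :
    (G.past i j').length < (G.past i j).length := by
  induction j using seqI_induction with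
  | root j hj => exact absurd (hj ▸ infoLESeq_seqI.2 h) not_infoLESeq_none
  | step j τ hj ih =>
    rw [past_eq_of_seqI_eq_some hj, List.length_cons]
    rw [← infoLESeq_seqI, hj, infoLESeq_some] at h
    rcases h with rfl | h
    · exact Nat.lt_succ_self _
    · exact (ih h).trans (Nat.lt_succ_self _)

theorem infoLT_irrefl (j : G.Info i) : ¬ InfoLT j j := fun h => lt_irrefl _ h.length_lt

theorem InfoLT.trans {j₁ j₂ j₃ : G.Info i} (h : InfoLT j₁ j₂) (h' : InfoLT j₂ j₃) :
    InfoLT j₁ j₃ := by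
  induction j₃ using seqI_induction with
  | root j hj => exact absurd (hj ▸ infoLESeq_seqI.2 h') not_infoLESeq_none
  | step j τ hj ih =>
    rw [← infoLESeq_seqI, hj, infoLESeq_some] at h' ⊢
    rcases h' with rfl | h'
    · exact Or.inr h
    · exact Or.inr (ih h')

theorem InfoLE.trans_lt {j₁ j₂ j₃ : G.Info i} (h : InfoLE j₁ j₂) (h' : InfoLT j₂ j₃) :
    InfoLT j₁ j₃ := by
  rcases h with rfl | h
  · exact h'
  · exact h.trans h'

theorem InfoLT.not_mem_past {j : G.Info i} {a : G.Act i j} : (⟨j, a⟩ : G.Trig i) ∉ G.past i j :=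
  fun h => infoLT_irrefl j ⟨a, h⟩

end ExtensiveGame

/-! ### Counterfactual regret minimization -/

namespace ExtensiveGame

variable {n : ℕ} {G : ExtensiveGame n} {i : Fin n}

theorem toSeqForm_of_not {j : G.Info i} {b : (j' : G.Info i) → G.Act i j' → ℝ} {σ : G.Seq i}
    (h : ¬ InfoLESeq j σ) : toSeqForm j b σ = 0 := by
  cases σ with
  | none => rfl
  | some τ => rw [infoLESeq_some] at h; simp [toSeqForm, h]

theorem toSeqForm_self (j : G.Info i) (b : (j' : G.Info i) → G.Act i j' → ℝ) (a : G.Act i j) :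
    toSeqForm j b (some ⟨j, a⟩) = b j a := by
  classical
  have h : InfoLE j j := Or.inl rfl
  have hf : (G.past i j).filter (fun τ' => decide (InfoLE j τ'.1)) = [] := by
    rw [List.filter_eq_nil_iff]
    rintro ⟨j', a'⟩ hm hle
    exact infoLT_irrefl j (InfoLE.trans_lt (of_decide_eq_true hle) ⟨a', hm⟩)
  simp [toSeqForm, h, hf]

theorem toSeqForm_of_lt {j j' : G.Info i} (h : InfoLT j j')
    (b : (j' : G.Info i) → G.Act i j' → ℝ) (a : G.Act i j') :
    toSeqForm j b (some ⟨j', a⟩) = toSeqForm j b (seqI j') * b j' a := by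
  have hle : InfoLE j j' := Or.inr h
  obtain ⟨τ, hτ⟩ : ∃ τ, seqI j' = some τ := by
    rw [← Option.ne_none_iff_exists']
    intro hn
    exact not_infoLESeq_none (hn ▸ infoLESeq_seqI.2 h)
  have hle' : InfoLE j τ.1 := by rwa [← infoLESeq_some, ← hτ, infoLESeq_seqI]
  rw [hτ]
  simp only [toSeqForm, hle, hle', if_true, past_eq_of_seqI_eq_some hτ]
  rw [List.filter_cons_of_pos (by simpa using hle)]
  rw [List.map_cons, List.prod_cons, mul_comm]

theorem toSeqForm_nonneg {b : (j' : G.Info i) → G.Act i j' → ℝ} (hb : ∀ j' a, 0 ≤ b j' a)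
    (j : G.Info i) (σ : G.Seq i) : 0 ≤ toSeqForm j b σ := by
  cases σ with
  | none => exact le_rfl
  | some τ =>
    simp only [toSeqForm]
    split_ifs
    · refine List.prod_nonneg fun x hx => ?_
      obtain ⟨τ', -, rfl⟩ := List.mem_map.1 hx
      exact hb _ _
    · exact le_rfl

theorem toSeqForm_mem_QSub {b : (j' : G.Info i) → G.Act i j' → ℝ}
    (hb : ∀ j', b j' ∈ stdSimplex ℝ (G.Act i j')) (j : G.Info i) : toSeqForm j b ∈ QSub j := by
  refine ⟨toSeqForm_nonneg (fun j' => (hb j').1) j, fun σ => toSeqForm_of_not, ?_, ?_⟩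
  · simp only [toSeqForm_self]
    exact (hb j).2
  · intro j' h
    simp only [toSeqForm_of_lt h, ← Finset.mul_sum, (hb j').2, mul_one]

theorem QSub_nonempty (j : G.Info i) : (QSub j).Nonempty :=
  ⟨_, toSeqForm_mem_QSub (fun _ => regretMatch_mem_stdSimplex 0) j⟩

theorem le_one_of_mem_QSub {j : G.Info i} {q : G.Seq i → ℝ} (hq : q ∈ QSub j) (σ : G.Seq i) :
    q σ ≤ 1 := by
  cases σ with
  | none => rw [hq.2.1 none not_infoLESeq_none]; exact zero_le_one
  | some τ =>
    obtain ⟨j', a⟩ := τ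
    have hle : q (some ⟨j', a⟩) ≤ ∑ a, q (some ⟨j', a⟩) :=
      Finset.single_le_sum (f := fun a => q (some ⟨j', a⟩)) (fun a _ => hq.1 _) (Finset.mem_univ a)
    by_cases h : InfoLESeq j (some ⟨j', a⟩)
    · rw [infoLESeq_some] at h
      induction j' using seqI_induction with
      | root j' hj' =>
        rcases h with rfl | h
        · rwa [hq.2.2.1] at hle
        · exact absurd (hj' ▸ infoLESeq_seqI.2 h) not_infoLESeq_none
      | step j' τ hτ ih =>
        rcases h with rfl | h
        · rwa [hq.2.2.1] at hle
        · rw [← hq.2.2.2 j' h, hτ] at hle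
          refine hle.trans (ih τ.2 ?_ ?_)
          · exact Finset.single_le_sum (f := fun a => q (some ⟨τ.1, a⟩)) (fun a _ => hq.1 _)
              (Finset.mem_univ τ.2)
          · rwa [← infoLESeq_some, ← hτ, infoLESeq_seqI]
    · rw [hq.2.1 _ h]; exact zero_le_one

theorem abs_le_one_of_mem_QSub {j : G.Info i} {q : G.Seq i → ℝ} (hq : q ∈ QSub j) (σ : G.Seq i) :
    |q σ| ≤ 1 := by
  rw [abs_of_nonneg (hq.1 σ)]
  exact le_one_of_mem_QSub hq σ

/-- The value of a behavioral strategy at an information set is the average of the values of its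
actions there. -/
theorem sum_mul_toSeqForm_update (j : G.Info i) (b : (j' : G.Info i) → G.Act i j' → ℝ)
    (σ : G.Seq i) :
    ∑ a, b j a * toSeqForm j (Function.update b j (Pi.single a 1)) σ = toSeqForm j b σ := by
  by_cases hσ : InfoLESeq j σ
  swap
  · simp [toSeqForm_of_not hσ]
  cases σ with
  | none => exact absurd hσ not_infoLESeq_none
  | some τ =>
    obtain ⟨j', a'⟩ := τ
    rw [infoLESeq_some] at hσ
    induction j' using seqI_induction with
    | root j' hj' =>
      rcases hσ with rfl | h
      · simp [toSeqForm_self, Pi.single_apply]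
      · exact absurd (hj' ▸ infoLESeq_seqI.2 h) not_infoLESeq_none
    | step j' τ hτ ih =>
      rcases hσ with rfl | h
      · simp [toSeqForm_self, Pi.single_apply]
      · have hne : j' ≠ j := fun e => infoLT_irrefl j (e ▸ h)
        have hle : InfoLE j τ.1 := by rwa [← infoLESeq_some, ← hτ, infoLESeq_seqI]
        simp only [toSeqForm_of_lt h, hτ, Function.update_of_ne hne]
        rw [← ih τ.2 hle, Finset.sum_mul]
        exact Finset.sum_congr rfl fun a _ => (mul_assoc _ _ _).symm

open Classical in
/-- The performance-difference identity behind CFR, for one sequence `σ`: the difference of a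
sequence-form strategy `ρ` and a behavioral strategy `b` is the sum over the information sets `j'`
of the differences that arise when `b` is changed at `j'` only, weighted by `ρ`.  Along the path to
`σ` the sum telescopes. -/
theorem sub_toSeqForm_apply {j : G.Info i} {ρ : G.Seq i → ℝ} (hρ : ρ ∈ QSub j)
    (b : (j' : G.Info i) → G.Act i j' → ℝ) (σ : G.Seq i) :
    ρ σ - toSeqForm j b σ = ∑ j' : G.Info i with InfoLE j j', ∑ a, ρ (some ⟨j', a⟩) *
      (toSeqForm j' (Function.update b j' (Pi.single a 1)) σ - toSeqForm j' b σ) := by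
  set D : G.Info i → G.Seq i → ℝ := fun j' σ => ∑ a, ρ (some ⟨j', a⟩) *
      (toSeqForm j' (Function.update b j' (Pi.single a 1)) σ - toSeqForm j' b σ) with hD
  have hD0 : ∀ j' σ, ¬ InfoLESeq j' σ → D j' σ = 0 := by
    intro j' σ h
    simp [hD, toSeqForm_of_not h]
  have hout : ∀ σ, ¬ InfoLESeq j σ →
      ρ σ - toSeqForm j b σ = ∑ j' : G.Info i with InfoLE j j', D j' σ := by
    intro σ h
    rw [hρ.2.1 σ h, toSeqForm_of_not h, sub_zero]
    refine (Finset.sum_eq_zero fun j' hj' => hD0 j' σ fun ⟨τ, hτ, hle⟩ => h ⟨τ, hτ, ?_⟩).symm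
    have hj := (Finset.mem_filter.1 hj').2
    rcases hle with rfl | hlt
    · exact hj
    · exact Or.inr (hj.trans_lt hlt)
  cases σ with
  | none => exact hout _ not_infoLESeq_none
  | some τ =>
    obtain ⟨j₁, a₁⟩ := τ
    have key : ∀ j₁ a₁,
        ρ (seqI j₁) - toSeqForm j b (seqI j₁) =
          ∑ j' : G.Info i with InfoLE j j', D j' (seqI j₁) →
        ρ (some ⟨j₁, a₁⟩) - toSeqForm j b (some ⟨j₁, a₁⟩) =
          ∑ j' : G.Info i with InfoLE j j', D j' (some ⟨j₁, a₁⟩) := by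
      intro j₁ a₁ hpar
      by_cases hle : InfoLE j j₁
      swap
      · exact hout _ (by rwa [infoLESeq_some])
      have hne : ∀ j', j' ≠ j₁ → D j' (some ⟨j₁, a₁⟩) = D j' (seqI j₁) * b j₁ a₁ := by
        intro j' hj'
        by_cases hlt : InfoLT j' j₁
        · simp only [hD, toSeqForm_of_lt hlt, Function.update_of_ne (Ne.symm hj'), Finset.sum_mul]
          exact Finset.sum_congr rfl fun a _ => by ring
        · rw [hD0 j' (seqI j₁) (by rwa [infoLESeq_seqI]), zero_mul, hD0]
          rw [infoLESeq_some]
          rintro (h | h)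
          · exact hj' h
          · exact hlt h
      have hself : D j₁ (some ⟨j₁, a₁⟩)
          = ρ (some ⟨j₁, a₁⟩) - (∑ a, ρ (some ⟨j₁, a⟩)) * b j₁ a₁ := by
        simp [hD, toSeqForm_self, Pi.single_apply, mul_sub, Finset.sum_sub_distrib, Finset.sum_mul]
      have hself0 : D j₁ (seqI j₁) = 0 := hD0 _ _ (by rw [infoLESeq_seqI]; exact infoLT_irrefl j₁)
      have hmem : j₁ ∈ Finset.univ.filter (fun j' => InfoLE j j') := by simpa using hle
      have hsum : ∑ j' : G.Info i with InfoLE j j', D j' (some ⟨j₁, a₁⟩)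
          = (∑ j' : G.Info i with InfoLE j j', D j' (seqI j₁)) * b j₁ a₁
            + D j₁ (some ⟨j₁, a₁⟩) := by
        rw [← Finset.sum_erase_add _ _ hmem, ← Finset.sum_erase_add _ _ hmem, hself0, add_zero,
          Finset.sum_mul]
        congr 1
        exact Finset.sum_congr rfl fun j' hj' => hne j' (Finset.ne_of_mem_erase hj')
      rw [hsum, ← hpar, hself]
      rcases hle with rfl | hlt
      · have hn : ¬ InfoLESeq j (seqI j) := by rw [infoLESeq_seqI]; exact infoLT_irrefl j
        rw [hρ.2.1 _ hn, toSeqForm_of_not hn, toSeqForm_self, hρ.2.2.1]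
        ring
      · rw [toSeqForm_of_lt hlt, ← hρ.2.2.2 j₁ hlt]
        ring
    induction j₁ using seqI_induction with
    | root j₁ h₁ => exact key j₁ a₁ (by rw [h₁]; exact hout _ not_infoLESeq_none)
    | step j₁ τ hτ ih => exact key j₁ a₁ (by rw [hτ]; exact ih τ.2)

open Classical in
theorem dotProduct_sub_toSeqForm {j : G.Info i} {ρ : G.Seq i → ℝ} (hρ : ρ ∈ QSub j)
    (b : (j' : G.Info i) → G.Act i j' → ℝ) (g : G.Seq i → ℝ) :
    g ⬝ᵥ ρ - g ⬝ᵥ toSeqForm j b = ∑ j' : G.Info i with InfoLE j j', ∑ a, ρ (some ⟨j', a⟩) *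
      (g ⬝ᵥ toSeqForm j' (Function.update b j' (Pi.single a 1)) - g ⬝ᵥ toSeqForm j' b) := by
  simp only [dotProduct, ← Finset.sum_sub_distrib, ← mul_sub]
  simp only [sub_toSeqForm_apply hρ b, Finset.mul_sum]
  rw [Finset.sum_comm]
  refine Finset.sum_congr rfl fun j' _ => ?_
  rw [Finset.sum_comm]
  exact Finset.sum_congr rfl fun a _ => Finset.sum_congr rfl fun σ _ => by ring

/-- The current behavioral strategy of CFR. -/
noncomputable def cfrBehavior (hist : List (G.Seq i → ℝ)) (j' : G.Info i) : G.Act i j' → ℝ :=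
  regretMatch (hist.foldl cfrStep 0 j')

/-- The increment of the counterfactual regret of an action. -/
noncomputable def cfrIncrement (b : (j' : G.Info i) → G.Act i j' → ℝ) (g : G.Seq i → ℝ)
    (j' : G.Info i) (a : G.Act i j') : ℝ :=
  g ⬝ᵥ toSeqForm j' (Function.update b j' (Pi.single a 1)) - g ⬝ᵥ toSeqForm j' b

theorem sum_mul_cfrIncrement {b : (j' : G.Info i) → G.Act i j' → ℝ}
    (hb : ∀ j', b j' ∈ stdSimplex ℝ (G.Act i j')) (g : G.Seq i → ℝ) (j' : G.Info i) :
    ∑ a, b j' a * cfrIncrement b g j' a = 0 := by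
  simp only [cfrIncrement, mul_sub, Finset.sum_sub_distrib, ← Finset.sum_mul, (hb j').2, one_mul]
  rw [sub_eq_zero]
  simp only [dotProduct, Finset.mul_sum]
  rw [Finset.sum_comm]
  refine Finset.sum_congr rfl fun σ _ => ?_
  rw [← sum_mul_toSeqForm_update j' b σ, Finset.mul_sum]
  exact Finset.sum_congr rfl fun a _ => by ring

theorem abs_cfrIncrement_le {b : (j' : G.Info i) → G.Act i j' → ℝ}
    (hb : ∀ j', b j' ∈ stdSimplex ℝ (G.Act i j')) {g : G.Seq i → ℝ} {B : ℝ}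
    (hg : ∀ σ, |g σ| ≤ B) (j' : G.Info i) (a : G.Act i j') :
    |cfrIncrement b g j' a| ≤ Fintype.card (G.Seq i) * B + Fintype.card (G.Seq i) * B := by
  refine (abs_sub _ _).trans (add_le_add (abs_dotProduct_le hg fun σ => ?_)
    (abs_dotProduct_le hg (abs_le_one_of_mem_QSub (toSeqForm_mem_QSub hb j'))))
  refine abs_le_one_of_mem_QSub (toSeqForm_mem_QSub (fun j'' => ?_) j') σ
  by_cases h : j'' = j'
  · subst h
    rw [Function.update_self]
    exact single_mem_stdSimplex ℝ a
  · rw [Function.update_of_ne h]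
    exact hb j''

theorem foldl_cfrStep_range (ℓ : ℕ → G.Seq i → ℝ) (j' : G.Info i) (a : G.Act i j') (T : ℕ) :
    ((List.range T).map ℓ).foldl cfrStep 0 j' a =
      ∑ t ∈ Finset.range T, cfrIncrement (cfrBehavior ((List.range t).map ℓ)) (ℓ t) j' a := by
  induction T with
  | zero => rfl
  | succ T ih =>
    rw [Finset.sum_range_succ, ← ih, List.range_succ, List.map_append, List.foldl_append]
    rfl

theorem eventually_sum_cfrIncrement_le {ℓ : ℕ → G.Seq i → ℝ} {B : ℝ} (hB : ∀ t σ, |ℓ t σ| ≤ B)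
    {ε : ℝ} (hε : 0 < ε) (j' : G.Info i) :
    ∀ᶠ T : ℕ in atTop, ∀ a,
      ∑ t ∈ Finset.range T, cfrIncrement (cfrBehavior ((List.range t).map ℓ)) (ℓ t) j' a
        ≤ ε * T := by
  have h := eventually_regret_le (ι := G.Act i j')
    (R := fun T => ((List.range T).map ℓ).foldl cfrStep 0 j')
    (v := fun t => cfrIncrement (cfrBehavior ((List.range t).map ℓ)) (ℓ t) j') rfl
    (fun t a => by rw [foldl_cfrStep_range, foldl_cfrStep_range, Finset.sum_range_succ])
    (fun t => sum_mul_cfrIncrement (b := cfrBehavior ((List.range t).map ℓ))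
      (fun _ => regretMatch_mem_stdSimplex _) (ℓ t) j')
    (fun t a => abs_cfrIncrement_le (fun _ => regretMatch_mem_stdSimplex _) (hB t) j' a) hε
  filter_upwards [h] with T hT a
  rw [← foldl_cfrStep_range]
  exact hT a

theorem isRegretMinimizer_cfr (j : G.Info i) : IsRegretMinimizer (QSub j) (cfr j) := by
  classical
  intro _
  refine ⟨fun hist => toSeqForm_mem_QSub (fun _ => regretMatch_mem_stdSimplex _) j, ?_⟩
  rintro ℓ ⟨B, hB⟩ ε hε
  obtain ⟨N, hN⟩ : ∃ N : ℝ, N = ∑ j' : G.Info i with InfoLE j j', ∑ _a : G.Act i j', (1 : ℝ) :=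
    ⟨_, rfl⟩
  have hN0 : 0 ≤ N := hN ▸ Finset.sum_nonneg fun _ _ => Finset.sum_nonneg fun _ _ => zero_le_one
  have hδ : 0 < ε / (N + 1) := by positivity
  filter_upwards [eventually_all.2 fun j' => eventually_sum_cfrIncrement_le hB hδ j'] with T hT ρ hρ
  calc ∑ t ∈ Finset.range T, (ℓ t ⬝ᵥ ρ - ℓ t ⬝ᵥ cfr j ((List.range t).map ℓ))
      = ∑ t ∈ Finset.range T, ∑ j' : G.Info i with InfoLE j j', ∑ a, ρ (some ⟨j', a⟩) *
          cfrIncrement (cfrBehavior ((List.range t).map ℓ)) (ℓ t) j' a :=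
        Finset.sum_congr rfl fun t _ => dotProduct_sub_toSeqForm hρ _ (ℓ t)
    _ = ∑ j' : G.Info i with InfoLE j j', ∑ a, ρ (some ⟨j', a⟩) * ∑ t ∈ Finset.range T,
          cfrIncrement (cfrBehavior ((List.range t).map ℓ)) (ℓ t) j' a := by
        rw [Finset.sum_comm]
        refine Finset.sum_congr rfl fun j' _ => ?_
        rw [Finset.sum_comm]
        exact Finset.sum_congr rfl fun a _ => by rw [← Finset.mul_sum]
    _ ≤ ∑ j' : G.Info i with InfoLE j j', ∑ _a : G.Act i j', 1 * (ε / (N + 1) * T) := by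
        refine Finset.sum_le_sum fun j' _ => Finset.sum_le_sum fun a _ => ?_
        exact (mul_le_mul_of_nonneg_left (hT j' a) (hρ.1 _)).trans
          (mul_le_mul_of_nonneg_right (le_one_of_mem_QSub hρ _)
            (mul_nonneg hδ.le (Nat.cast_nonneg T)))
    _ = N / (N + 1) * (ε * T) := by
        simp_rw [← Finset.sum_mul]
        rw [← hN]
        ring
    _ ≤ 1 * (ε * T) := by
        refine mul_le_mul_of_nonneg_right ?_ (by positivity)
        rw [div_le_one (by positivity)]
        linarith
    _ = ε * T := one_mul _

end ExtensiveGame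

/-! ### Fixed points of trigger deviation functions -/

namespace ExtensiveGame

variable {n : ℕ} {G : ExtensiveGame n} {i : Fin n}

open Classical in
theorem devMatrix_mulVec (τ : G.Trig i) (y x : G.Seq i → ℝ) (σ : G.Seq i) :
    (devMatrix τ y).mulVec x σ =
      (if TrigLE τ σ then 0 else x σ) + (if InfoLESeq τ.1 σ then y σ * x (some τ) else 0) := by
  have hτ : TrigLE τ (some τ) := trigLE_some.2 (Or.inl rfl)
  have : ∀ c, devMatrix τ y σ c * x c =
      (if σ = c then (if TrigLE τ σ then 0 else x σ) else 0) +
      (if some τ = c then (if InfoLESeq τ.1 σ then y σ * x (some τ) else 0) else 0) := by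
    intro c
    unfold devMatrix
    by_cases h1 : σ = c
    · subst h1
      by_cases h2 : some τ = σ
      · subst h2; simp [hτ]
      · by_cases h3 : TrigLE τ σ <;> simp [h2, h3, Ne.symm h2]
    · by_cases h2 : some τ = c
      · subst h2; simp [h1]
      · simp [h1, h2, Ne.symm h2]
  simp only [Matrix.mulVec, dotProduct, this, Finset.sum_add_distrib, Finset.sum_ite_eq,
    Finset.mem_univ, if_true]

open Classical in
theorem sum_filter_fst (p : G.Info i → Prop) (f : G.Trig i → ℝ) :
    ∑ j' : G.Info i with p j', ∑ a', f ⟨j', a'⟩ = ∑ τ : G.Trig i with p τ.1, f τ := by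
  rw [Finset.sum_filter, Finset.sum_filter, Fintype.sum_sigma]
  refine Finset.sum_congr rfl fun j' _ => ?_
  by_cases h : p j' <;> simp [h]

open Classical in
theorem sum_filter_infoLE (j : G.Info i) (f : G.Trig i → ℝ) :
    ∑ τ : G.Trig i with InfoLE τ.1 j, f τ =
      ∑ τ : G.Trig i with InfoLT τ.1 j, f τ + ∑ a, f ⟨j, a⟩ := by
  rw [← sum_filter_fst (fun j' => InfoLE j' j), ← sum_filter_fst (fun j' => InfoLT j' j)]
  have : Finset.univ.filter (fun j' => InfoLE j' j) =
      insert j (Finset.univ.filter (fun j' => InfoLT j' j)) := by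
    ext j'
    rw [Finset.mem_filter, Finset.mem_insert, Finset.mem_filter]
    simp [InfoLE]
  rw [this, Finset.sum_insert (by simpa using infoLT_irrefl j), add_comm]

open Classical in
/-- A vector satisfies the row of the fixed-point equation of `∑ τ, lam τ • devMatrix τ (y τ)` that
belongs to the sequence `(j, a)`; here the weights `lam` are assumed to sum to one. -/
def RowFixed (lam : G.Trig i → ℝ) (y : G.Trig i → G.Seq i → ℝ) (x : G.Seq i → ℝ)
    (τ₀ : G.Trig i) : Prop :=
  x (some τ₀) * (1 - ∑ τ : G.Trig i with TrigLE τ (some τ₀), lam τ)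
    + ∑ τ : G.Trig i with InfoLE τ.1 τ₀.1, lam τ * y τ (some τ₀) * x (some τ) = x (some τ₀)

/-- A nonnegative vector that satisfies the sequence-form constraints and the fixed-point equation
at the information sets in `S`. -/
def IsPartialFixedPoint (lam : G.Trig i → ℝ) (y : G.Trig i → G.Seq i → ℝ) (S : Set (G.Info i))
    (x : G.Seq i → ℝ) : Prop :=
  (∀ σ, 0 ≤ x σ) ∧ x none = 1 ∧
    ∀ j ∈ S, x (seqI j) = ∑ a, x (some ⟨j, a⟩) ∧ ∀ a, RowFixed lam y x ⟨j, a⟩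

section Extend

variable {F : (j : G.Info i) → Matrix (G.Act i j) (G.Act i j) ℝ → G.Act i j → ℝ}
  {lam : G.Trig i → ℝ} {y : G.Trig i → G.Seq i → ℝ} {x : G.Seq i → ℝ} {j : G.Info i}

theorem extend_of_ne {τ : G.Trig i} (h : τ.1 ≠ j) :
    extend F lam y x j (some τ) = x (some τ) := by
  simp [extend, h]

theorem extend_seqI_of_not_lt {j' : G.Info i} (h : ¬ InfoLT j j') :
    extend F lam y x j (seqI j') = x (seqI j') := by
  cases hj : seqI j' with
  | none => rfl
  | some τ => exact extend_of_ne fun e => h (e ▸ infoLT_of_seqI_eq_some hj)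

variable (lam y x j) in
open Classical in
/-- The mass that trigger deviations at strict ancestors of `j` move to the sequence `(j, a)`. -/
noncomputable def inflow (a : G.Act i j) : ℝ :=
  ∑ τ : G.Trig i with InfoLT τ.1 j, lam τ * y τ (some ⟨j, a⟩) * x (some τ)

variable (lam y x j) in
open Classical in
/-- The matrix whose normalization is passed to the fixed-point oracle at `j`. -/
noncomputable def localMatrix : Matrix (G.Act i j) (G.Act i j) ℝ := fun ar ac =>
  inflow lam y x j ar + (lam ⟨j, ac⟩ * y ⟨j, ac⟩ (some ⟨j, ar⟩)
    + (1 - ∑ τ : G.Trig i with TrigLE τ (some ⟨j, ac⟩), lam τ) * (if ar = ac then 1 else 0))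
    * x (seqI j)

open Classical in
theorem extend_self (a : G.Act i j) : extend F lam y x j (some ⟨j, a⟩) =
    (if x (seqI j) = 0 then 0
      else x (seqI j) • F j ((x (seqI j))⁻¹ • localMatrix lam y x j)) a := by
  have h : ∀ a, inflow lam y x j a = ∑ j' : G.Info i with InfoLESeq j' (seqI j),
      ∑ a' : G.Act i j', lam ⟨j', a'⟩ * y ⟨j', a'⟩ (some ⟨j, a⟩) * x (some ⟨j', a'⟩) := by
    intro a
    simp only [infoLESeq_seqI]
    exact (sum_filter_fst (fun j' => InfoLT j' j)
      (fun τ => lam τ * y τ (some ⟨j, a⟩) * x (some τ))).symm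
  simp only [extend, dite_true]
  unfold localMatrix
  simp only [h]

theorem RowFixed.extend_of_not_le {τ₀ : G.Trig i} (h : RowFixed lam y x τ₀)
    (hne : τ₀.1 ≠ j) (hlt : ¬ InfoLT j τ₀.1) : RowFixed lam y (extend F lam y x j) τ₀ := by
  classical
  unfold RowFixed at h ⊢
  rw [extend_of_ne hne]
  convert h using 2
  refine Finset.sum_congr rfl fun τ hτ => ?_
  rw [extend_of_ne]
  rintro rfl
  rcases (Finset.mem_filter.1 hτ).2 with e | e
  · exact hne e.symm
  · exact hlt e

theorem inflow_nonneg (hlam : lam ∈ stdSimplex ℝ (G.Trig i)) (hy : ∀ τ : G.Trig i, y τ ∈ QSub τ.1)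
    (hx : ∀ σ, 0 ≤ x σ) (a : G.Act i j) : 0 ≤ inflow lam y x j a :=
  Finset.sum_nonneg fun τ _ => mul_nonneg (mul_nonneg (hlam.1 τ) ((hy τ).1 _)) (hx _)

open Classical in
theorem sum_trigLE_some (a : G.Act i j) : ∑ τ : G.Trig i with TrigLE τ (some ⟨j, a⟩), lam τ =
    lam ⟨j, a⟩ + ∑ τ : G.Trig i with TrigLE τ (seqI j), lam τ := by
  have : Finset.univ.filter (fun τ : G.Trig i => TrigLE τ (some ⟨j, a⟩)) =
      insert ⟨j, a⟩ (Finset.univ.filter (fun τ : G.Trig i => TrigLE τ (seqI j))) := by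
    ext τ
    rw [Finset.mem_filter, Finset.mem_insert, Finset.mem_filter, trigLE_seqI, trigLE_some]
    simp
  rw [this, Finset.sum_insert]
  rw [Finset.mem_filter, trigLE_seqI]
  exact fun h => InfoLT.not_mem_past h.2

open Classical in
/-- The total inflow at an information set, computed from the fixed-point equation for the parent
sequence. -/
theorem sum_inflow (hy : ∀ τ : G.Trig i, y τ ∈ QSub τ.1)
    (hpar : ∀ τ, seqI j = some τ → RowFixed lam y x τ) :
    ∑ a, inflow lam y x j a = (∑ τ : G.Trig i with TrigLE τ (seqI j), lam τ) * x (seqI j) := by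
  have h : ∑ a, inflow lam y x j a =
      ∑ τ : G.Trig i with InfoLESeq τ.1 (seqI j), lam τ * y τ (seqI j) * x (some τ) := by
    simp only [inflow, infoLESeq_seqI]
    rw [Finset.sum_comm]
    refine Finset.sum_congr rfl fun τ hτ => ?_
    rw [(hy τ).2.2.2 j (Finset.mem_filter.1 hτ).2, Finset.mul_sum, Finset.sum_mul]
  rw [h]
  cases hj : seqI j with
  | none => simp [not_infoLESeq_none, not_trigLE_none]
  | some τ =>
    have := hpar τ hj
    simp only [infoLESeq_some]
    unfold RowFixed at this
    linarith

theorem localMatrix_smul_nonneg (hlam : lam ∈ stdSimplex ℝ (G.Trig i))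
    (hy : ∀ τ : G.Trig i, y τ ∈ QSub τ.1) (hx : ∀ σ, 0 ≤ x σ) (ar ac : G.Act i j) :
    0 ≤ ((x (seqI j))⁻¹ • localMatrix lam y x j) ar ac := by
  classical
  have h1 : ∑ τ : G.Trig i with TrigLE τ (some ⟨j, ac⟩), lam τ ≤ 1 := by
    rw [← hlam.2]
    exact Finset.sum_le_univ_sum_of_nonneg hlam.1
  refine mul_nonneg (inv_nonneg.2 (hx _)) (add_nonneg (inflow_nonneg hlam hy hx ar)
    (mul_nonneg (add_nonneg (mul_nonneg (hlam.1 _) ((hy _).1 _)) (mul_nonneg ?_ ?_)) (hx _)))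
  · convert sub_nonneg.2 h1
  · split_ifs <;> norm_num

theorem sum_localMatrix_smul (hy : ∀ τ : G.Trig i, y τ ∈ QSub τ.1)
    (hpar : ∀ τ, seqI j = some τ → RowFixed lam y x τ) (hx0 : x (seqI j) ≠ 0) (ac : G.Act i j) :
    ∑ ar, ((x (seqI j))⁻¹ • localMatrix lam y x j) ar ac = 1 := by
  classical
  have h1 := (hy ⟨j, ac⟩).2.2.1
  simp only [Matrix.smul_apply, localMatrix, smul_eq_mul, ← Finset.mul_sum, Finset.sum_add_distrib,
    sum_inflow hy hpar, ← Finset.sum_mul, h1, sum_trigLE_some]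
  rw [inv_mul_eq_one₀ hx0]
  simp only [Finset.sum_ite_eq', Finset.mem_univ, if_true]
  ring

/-- After the information set `j` has been treated, the sequence-form constraint and the rows of the
fixed-point equation hold there. -/
theorem extend_spec (hF : IsFixedPointOracle (F j)) (hlam : lam ∈ stdSimplex ℝ (G.Trig i))
    (hy : ∀ τ : G.Trig i, y τ ∈ QSub τ.1) (hx : ∀ σ, 0 ≤ x σ)
    (hpar : ∀ τ, seqI j = some τ → RowFixed lam y x τ) :
    (∀ a, 0 ≤ extend F lam y x j (some ⟨j, a⟩)) ∧
    ∑ a, extend F lam y x j (some ⟨j, a⟩) = x (seqI j) ∧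
    ∀ a, RowFixed lam y (extend F lam y x j) ⟨j, a⟩ := by
  classical
  have hrow : ∀ a, inflow lam y x j a
      + ∑ ac, lam ⟨j, ac⟩ * y ⟨j, ac⟩ (some ⟨j, a⟩) * extend F lam y x j (some ⟨j, ac⟩)
      + (1 - ∑ τ : G.Trig i with TrigLE τ (some ⟨j, a⟩), lam τ)
        * extend F lam y x j (some ⟨j, a⟩) = extend F lam y x j (some ⟨j, a⟩) →
      RowFixed lam y (extend F lam y x j) ⟨j, a⟩ := by
    intro a h
    unfold RowFixed
    rw [sum_filter_infoLE]
    have : ∑ τ : G.Trig i with InfoLT τ.1 j,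
        lam τ * y τ (some ⟨j, a⟩) * extend F lam y x j (some τ) = inflow lam y x j a := by
      refine Finset.sum_congr rfl fun τ hτ => ?_
      rw [extend_of_ne]
      intro e
      exact infoLT_irrefl j (e ▸ (Finset.mem_filter.1 hτ).2)
    rw [this]
    linarith
  have hsum := sum_inflow hy hpar
  by_cases hx0 : x (seqI j) = 0
  · have hz : ∀ a, extend F lam y x j (some ⟨j, a⟩) = 0 := by
      intro a
      rw [extend_self, if_pos hx0, Pi.zero_apply]
    rw [hx0, mul_zero] at hsum
    -- The inflow vanishes, because it is nonnegative and its total is proportional to the mass of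
    -- the parent sequence.
    have hin := (Finset.sum_eq_zero_iff_of_nonneg fun a _ => inflow_nonneg hlam hy hx a).1 hsum
    refine ⟨fun a => (hz a).ge, by simp [hz, hx0], fun a => hrow a ?_⟩
    simp [hz, hin a (Finset.mem_univ a)]
  · obtain ⟨hmem, hfix⟩ := hF ((x (seqI j))⁻¹ • localMatrix lam y x j)
      (localMatrix_smul_nonneg hlam hy hx) (sum_localMatrix_smul hy hpar hx0)
    set b := F j ((x (seqI j))⁻¹ • localMatrix lam y x j) with hb
    have hw : ∀ a, extend F lam y x j (some ⟨j, a⟩) = x (seqI j) * b a := by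
      intro a
      rw [extend_self, if_neg hx0]
      rfl
    refine ⟨fun a => (hw a).symm ▸ mul_nonneg (hx _) (hmem.1 a), ?_, fun a => hrow a ?_⟩
    · simp only [hw, ← Finset.mul_sum, hmem.2, mul_one]
    · have h : ∑ ac, localMatrix lam y x j a ac * b ac = x (seqI j) * b a := by
        have h := congrFun hfix a
        have h' : b a = (x (seqI j))⁻¹ * ∑ ac, localMatrix lam y x j a ac * b ac := by
          rw [← h, Finset.mul_sum]
          exact Finset.sum_congr rfl fun _ _ => mul_assoc _ _ _
        rw [h', mul_inv_cancel_left₀ hx0]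
      simp only [localMatrix, add_mul, Finset.sum_add_distrib, ← Finset.mul_sum, hmem.2, mul_one]
        at h
      simp only [hw]
      conv_rhs => rw [← h]
      rw [add_assoc]
      congr 2
      · exact Finset.sum_congr rfl fun ac _ => by ring
      · simp only [mul_ite, mul_one, mul_zero, ite_mul, zero_mul, Finset.sum_ite_eq,
          Finset.mem_univ, if_true]
        ring

end Extend

/-- The invariant of the fixed-point algorithm. In a top-down order the parent of an information set
has been treated before it, and its treatment changes no entry that occurs in the constraints of the
information sets treated earlier. -/
theorem foldl_extend {F : (j : G.Info i) → Matrix (G.Act i j) (G.Act i j) ℝ → G.Act i j → ℝ}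
    (hF : ∀ j, IsFixedPointOracle (F j)) {lam : G.Trig i → ℝ}
    (hlam : lam ∈ stdSimplex ℝ (G.Trig i)) {y : G.Trig i → G.Seq i → ℝ}
    (hy : ∀ τ : G.Trig i, y τ ∈ QSub τ.1) (l pre : List (G.Info i)) (x : G.Seq i → ℝ)
    (hl : IsTopDown (pre ++ l)) (hx : IsPartialFixedPoint lam y {j | j ∈ pre} x) :
    IsPartialFixedPoint lam y Set.univ (l.foldl (extend F lam y) x) := by
  induction l generalizing pre x with
  | nil =>
    refine ⟨hx.1, hx.2.1, fun j _ => hx.2.2 j ?_⟩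
    simpa using hl.2.1 j
  | cons j l ih =>
    rw [List.foldl_cons]
    refine ih (pre ++ [j]) _ (by simpa using hl) ?_
    obtain ⟨hnd, hall, hpw⟩ := hl
    have hpar : ∀ τ, seqI j = some τ → RowFixed lam y x τ := by
      intro τ hτ
      have hlt := infoLT_of_seqI_eq_some hτ
      have hm : τ.1 ∈ pre := by
        rcases List.mem_append.1 (hall τ.1) with h | h
        · exact h
        · rcases List.mem_cons.1 h with h | h
          · exact absurd (h ▸ hlt) (infoLT_irrefl j)
          · rw [List.pairwise_append, List.pairwise_cons] at hpw
            exact absurd hlt (hpw.2.1.1 _ h)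
      exact (hx.2.2 τ.1 hm).2 τ.2
    obtain ⟨h1, h2, h3⟩ := extend_spec (hF j) hlam hy hx.1 hpar
    refine ⟨?_, hx.2.1, ?_⟩
    · rintro (_ | ⟨j', a'⟩)
      · exact hx.1 none
      · by_cases h : j' = j
        · subst h
          exact h1 a'
        · rw [extend_of_ne h]
          exact hx.1 _
    · intro j' hj'
      rcases List.mem_append.1 (show j' ∈ pre ++ [j] from hj') with h | h
      · have hne : j' ≠ j := fun e =>
          List.disjoint_of_nodup_append hnd h (e ▸ List.mem_cons_self)
        have hlt : ¬ InfoLT j j' := by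
          rw [List.pairwise_append] at hpw
          exact hpw.2.2 _ h _ List.mem_cons_self
        refine ⟨?_, fun a => ((hx.2.2 j' h).2 a).extend_of_not_le hne hlt⟩
        rw [extend_seqI_of_not_lt hlt, (hx.2.2 j' h).1]
        exact Finset.sum_congr rfl fun a _ => (extend_of_ne hne).symm
      · obtain rfl := List.mem_singleton.1 h
        exact ⟨by rw [extend_seqI_of_not_lt (infoLT_irrefl j'), h2], h3⟩

theorem fixedPoint_spec {F : (j : G.Info i) → Matrix (G.Act i j) (G.Act i j) ℝ → G.Act i j → ℝ}
    (hF : ∀ j, IsFixedPointOracle (F j)) {lam : G.Trig i → ℝ}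
    (hlam : lam ∈ stdSimplex ℝ (G.Trig i)) {y : G.Trig i → G.Seq i → ℝ}
    (hy : ∀ τ : G.Trig i, y τ ∈ QSub τ.1) {order : List (G.Info i)} (ho : IsTopDown order) :
    IsPartialFixedPoint lam y Set.univ (fixedPoint F order lam y) := by
  refine foldl_extend hF hlam hy order [] _ ho ⟨fun σ => ?_, by simp, by simp⟩
  rw [Pi.single_apply]
  split_ifs <;> norm_num

theorem IsPartialFixedPoint.mem_Q {lam : G.Trig i → ℝ} {y : G.Trig i → G.Seq i → ℝ}
    {x : G.Seq i → ℝ} (h : IsPartialFixedPoint lam y Set.univ x) : x ∈ G.Q i :=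
  ⟨h.1, h.2.1, fun j => (h.2.2 j trivial).1⟩

theorem IsPartialFixedPoint.sum_devMatrix_mulVec {lam : G.Trig i → ℝ}
    (hlam : lam ∈ stdSimplex ℝ (G.Trig i)) {y : G.Trig i → G.Seq i → ℝ} {x : G.Seq i → ℝ}
    (h : IsPartialFixedPoint lam y Set.univ x) (σ : G.Seq i) :
    ∑ τ, lam τ * (devMatrix τ (y τ)).mulVec x σ = x σ := by
  classical
  have h1 : ∑ τ, lam τ * (if TrigLE τ σ then 0 else x σ) =
      x σ * (1 - ∑ τ : G.Trig i with TrigLE τ σ, lam τ) := by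
    rw [← hlam.2, Finset.sum_filter, ← Finset.sum_sub_distrib, Finset.mul_sum]
    refine Finset.sum_congr rfl fun τ _ => ?_
    by_cases hτ : TrigLE τ σ <;> simp [hτ, mul_comm]
  simp only [devMatrix_mulVec, mul_add, Finset.sum_add_distrib]
  rw [h1]
  cases σ with
  | none => simp [not_trigLE_none, not_infoLESeq_none]
  | some τ₀ =>
    have := (h.2.2 τ₀.1 trivial).2 τ₀.2
    unfold RowFixed at this
    conv_rhs => rw [← this]
    congr 1
    rw [Finset.sum_filter]
    refine Finset.sum_congr rfl fun τ _ => ?_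
    by_cases hτ : InfoLE τ.1 τ₀.1 <;> simp [hτ, infoLESeq_some, mul_assoc]

theorem le_one_of_mem_Q {q : G.Seq i → ℝ} (hq : q ∈ G.Q i) (σ : G.Seq i) : q σ ≤ 1 := by
  have hle : ∀ τ : G.Trig i, q (some τ) ≤ q (seqI τ.1) := fun τ => by
    rw [hq.2.2 τ.1]
    exact Finset.single_le_sum (f := fun a => q (some ⟨τ.1, a⟩)) (fun a _ => hq.1 _)
      (Finset.mem_univ τ.2)
  have hseq : ∀ j : G.Info i, q (seqI j) ≤ 1 := fun j => by
    induction j using seqI_induction with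
    | root j h => rw [h, hq.2.1]
    | step j τ h ih => rw [h]; exact (hle τ).trans ih
  cases σ with
  | none => exact hq.2.1.le
  | some τ => exact (hle τ).trans (hseq τ.1)

theorem abs_le_one_of_mem_Q {q : G.Seq i → ℝ} (hq : q ∈ G.Q i) (σ : G.Seq i) : |q σ| ≤ 1 := by
  rw [abs_of_nonneg (hq.1 σ)]
  exact le_one_of_mem_Q hq σ

end ExtensiveGame

/-! ### Regret of the algorithm with respect to trigger deviations -/

namespace ExtensiveGame

variable {n : ℕ} {G : ExtensiveGame n} {i : Fin n}

open Classical in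
theorem dotProduct_devMatrix_sub (τ : G.Trig i) (ℓ q x : G.Seq i → ℝ) :
    ℓ ⬝ᵥ (devMatrix τ x).mulVec q - ℓ ⬝ᵥ (devMatrix τ 0).mulVec q =
      (fun σ => if InfoLESeq τ.1 σ then ℓ σ * q (some τ) else 0) ⬝ᵥ x := by
  simp only [dotProduct, ← Finset.sum_sub_distrib, devMatrix_mulVec]
  refine Finset.sum_congr rfl fun σ _ => ?_
  by_cases h : InfoLESeq τ.1 σ
  · simp only [h, if_true, Pi.zero_apply]
    ring
  · simp [h]

/-- The utilities that the rule of a trigger sequence observes represent the linear functional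
`x ↦ L (devMatrix τ x) - L (devMatrix τ 0)`. -/
theorem dotProduct_contUtility (τ : G.Trig i) (ℓ q x : G.Seq i → ℝ) :
    (fun σ => ℓ ⬝ᵥ (devMatrix τ (Pi.single σ 1)).mulVec q - ℓ ⬝ᵥ (devMatrix τ 0).mulVec q) ⬝ᵥ x =
      ℓ ⬝ᵥ (devMatrix τ x).mulVec q - ℓ ⬝ᵥ (devMatrix τ 0).mulVec q := by
  classical
  simp only [dotProduct_devMatrix_sub, dotProduct_single, mul_one]

theorem abs_devMatrix_mulVec_le {τ : G.Trig i} {y q : G.Seq i → ℝ} (hy : y ∈ QSub τ.1)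
    (hq : q ∈ G.Q i) (σ : G.Seq i) : |(devMatrix τ y).mulVec q σ| ≤ 2 := by
  classical
  rw [devMatrix_mulVec]
  refine (abs_add_le _ _).trans ((add_le_add (b := 1) (d := 1) ?_ ?_).trans (by norm_num))
  · split_ifs
    · simp
    · exact abs_le_one_of_mem_Q hq σ
  · split_ifs
    · rw [abs_mul]
      exact mul_le_one₀ (abs_le_one_of_mem_QSub hy σ) (abs_nonneg _) (abs_le_one_of_mem_Q hq _)
    · simp

namespace Params

variable {A : G.Params i}

theorem UsesCFR.noRegret (h : A.UsesCFR) : A.NoRegret := by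
  refine ⟨?_, fun τ => ?_⟩
  · rw [h.1]
    exact isRegretMinimizer_regretMatching
  · rw [h.2]
    exact isRegretMinimizer_cfr τ.1

theorem NoRegret.weights_mem (h : A.NoRegret) (τ : G.Trig i) (s : State G i) :
    A.weights s ∈ stdSimplex ℝ (G.Trig i) := by
  classical
  exact (h.1 ⟨_, single_mem_stdSimplex ℝ τ⟩).1 _

theorem NoRegret.conts_mem (h : A.NoRegret) (s : State G i) (τ : G.Trig i) :
    A.conts s τ ∈ QSub τ.1 :=
  (h.2 τ (QSub_nonempty τ.1)).1 _

theorem NoRegret.isPartialFixedPoint_nextMixed (h : A.NoRegret) (hA : A.Admissible)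
    (τ : G.Trig i) (s : State G i) :
    IsPartialFixedPoint (A.weights s) (A.conts s) Set.univ (A.nextMixed s) :=
  fixedPoint_spec hA.1 (h.weights_mem τ s) (h.conts_mem s) hA.2

theorem NoRegret.nextMixed_mem_Q (h : A.NoRegret) (hA : A.Admissible) (s : State G i) :
    A.nextMixed s ∈ G.Q i := by
  rcases isEmpty_or_nonempty (G.Info i) with he | ⟨⟨j⟩⟩
  · -- Without information sets the simplex of weights is empty, and `NoRegret` says nothing about
    -- the weights; but then the algorithm returns the trivial strategy.
    have ho : A.order = [] := List.eq_nil_iff_forall_not_mem.2 fun j => he.elim j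
    unfold nextMixed fixedPoint
    rw [ho, List.foldl_nil]
    refine ⟨fun σ => ?_, by simp, fun j => he.elim j⟩
    rw [Pi.single_apply]
    split_ifs <;> norm_num
  · obtain ⟨a⟩ := G.act_nonempty i j
    exact (h.isPartialFixedPoint_nextMixed hA ⟨j, a⟩ s).mem_Q

theorem NoRegret.mixed_mem_Q (h : A.NoRegret) (hA : A.Admissible) (hist : List (G.Seq i → ℝ)) :
    A.mixed hist ∈ G.Q i :=
  h.nextMixed_mem_Q hA _

variable (A) in
/-- The state of the algorithm after it has observed the first `t` utilities. -/
noncomputable def stateAt (ℓ : ℕ → G.Seq i → ℝ) (t : ℕ) : State G i :=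
  ((List.range t).map ℓ).foldl A.observe ([], fun _ => [])

variable (A) in
/-- The utility of the rule for the simplex at time `t`. -/
noncomputable def simplexUtility (ℓ : ℕ → G.Seq i → ℝ) (t : ℕ) : G.Trig i → ℝ := fun τ =>
  ℓ t ⬝ᵥ (devMatrix τ (A.conts (A.stateAt ℓ t) τ)).mulVec (A.nextMixed (A.stateAt ℓ t))

variable (A) in
/-- The utility of the rule of the trigger sequence `τ` at time `t`. -/
noncomputable def contUtility (ℓ : ℕ → G.Seq i → ℝ) (τ : G.Trig i) (t : ℕ) : G.Seq i → ℝ :=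
  fun σ => ℓ t ⬝ᵥ (devMatrix τ (Pi.single σ 1)).mulVec (A.nextMixed (A.stateAt ℓ t))
    - ℓ t ⬝ᵥ (devMatrix τ 0).mulVec (A.nextMixed (A.stateAt ℓ t))

theorem stateAt_succ (ℓ : ℕ → G.Seq i → ℝ) (t : ℕ) : A.stateAt ℓ (t + 1) =
    ((A.stateAt ℓ t).1 ++ [A.simplexUtility ℓ t],
      fun τ => (A.stateAt ℓ t).2 τ ++ [A.contUtility ℓ τ t]) := by
  unfold stateAt
  rw [List.range_succ, List.map_append, List.foldl_append]
  rfl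

theorem stateAt_fst (ℓ : ℕ → G.Seq i → ℝ) (t : ℕ) :
    (A.stateAt ℓ t).1 = (List.range t).map (A.simplexUtility ℓ) := by
  induction t with
  | zero => rfl
  | succ t ih => rw [stateAt_succ, List.range_succ, List.map_append, ih]; rfl

theorem stateAt_snd (ℓ : ℕ → G.Seq i → ℝ) (τ : G.Trig i) (t : ℕ) :
    (A.stateAt ℓ t).2 τ = (List.range t).map (A.contUtility ℓ τ) := by
  induction t with
  | zero => rfl
  | succ t ih => rw [stateAt_succ, List.range_succ, List.map_append, ← ih]; rfl

/-- Since the strategies are fixed points of the transformations, the utility of a strategy is the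
utility of the weights for the rule for the simplex. -/
theorem NoRegret.simplexUtility_dotProduct (h : A.NoRegret) (hA : A.Admissible)
    (ℓ : ℕ → G.Seq i → ℝ) (τ : G.Trig i) (t : ℕ) :
    A.simplexUtility ℓ t ⬝ᵥ A.simplexRule ((List.range t).map (A.simplexUtility ℓ)) =
      ℓ t ⬝ᵥ A.nextMixed (A.stateAt ℓ t) := by
  rw [← stateAt_fst]
  change _ ⬝ᵥ A.weights (A.stateAt ℓ t) = _
  have hfix := (h.isPartialFixedPoint_nextMixed hA τ (A.stateAt ℓ t)).sum_devMatrix_mulVec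
    (h.weights_mem τ _)
  simp only [dotProduct, simplexUtility, Finset.sum_mul]
  rw [Finset.sum_comm]
  refine Finset.sum_congr rfl fun σ _ => ?_
  rw [← hfix σ, Finset.mul_sum]
  exact Finset.sum_congr rfl fun τ _ => by ring

/-- The mixed strategies computed by the algorithm have sublinear regret with respect to every
trigger deviation: the regret is the sum of the regret of the rule for the simplex and of the regret
of the rule of the trigger sequence. -/
theorem NoRegret.eventually_trigger_regret_le (h : A.NoRegret) (hA : A.Admissible)
    {ℓ : ℕ → G.Seq i → ℝ} {B : ℝ} (hB : ∀ t σ, |ℓ t σ| ≤ B) (τ : G.Trig i) {ε : ℝ} (hε : 0 < ε) :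
    ∀ᶠ T : ℕ in atTop, ∀ ρ ∈ QSub τ.1, ∑ t ∈ Finset.range T,
      (ℓ t ⬝ᵥ (devMatrix τ ρ).mulVec (A.mixed ((List.range t).map ℓ))
        - ℓ t ⬝ᵥ A.mixed ((List.range t).map ℓ)) ≤ ε * T := by
  classical
  have hq : ∀ t, A.nextMixed (A.stateAt ℓ t) ∈ G.Q i := fun t => h.nextMixed_mem_Q hA _
  have hτ := single_mem_stdSimplex ℝ τ
  have hS := (h.1 ⟨_, hτ⟩).2 (A.simplexUtility ℓ)
    ⟨Fintype.card (G.Seq i) * (B * 2), fun t τ' => abs_dotProduct_le_mul (hB t) fun σ =>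
      abs_devMatrix_mulVec_le (h.conts_mem _ τ') (hq t) σ⟩ (ε / 2) (by positivity)
  have hC := (h.2 τ (QSub_nonempty τ.1)).2 (A.contUtility ℓ τ) ⟨B, fun t σ => by
      have hB0 := (abs_nonneg _).trans (hB t σ)
      unfold contUtility
      rw [dotProduct_devMatrix_sub, dotProduct_single, mul_one]
      split_ifs
      · rw [abs_mul]
        exact (mul_le_mul (hB t σ) (abs_le_one_of_mem_Q (hq t) _) (abs_nonneg _) hB0).trans_eq
          (mul_one B)
      · rwa [abs_zero]⟩ (ε / 2) (by positivity)
  filter_upwards [hS, hC] with T hST hCT ρ hρ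
  have h1 := hST _ hτ
  have h2 := hCT ρ hρ
  calc ∑ t ∈ Finset.range T, (ℓ t ⬝ᵥ (devMatrix τ ρ).mulVec (A.mixed ((List.range t).map ℓ))
        - ℓ t ⬝ᵥ A.mixed ((List.range t).map ℓ))
      = ∑ t ∈ Finset.range T, (A.simplexUtility ℓ t ⬝ᵥ Pi.single τ 1 - A.simplexUtility ℓ t ⬝ᵥ
            A.simplexRule ((List.range t).map (A.simplexUtility ℓ)))
        + ∑ t ∈ Finset.range T, (A.contUtility ℓ τ t ⬝ᵥ ρ - A.contUtility ℓ τ t ⬝ᵥ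
            A.contRule τ ((List.range t).map (A.contUtility ℓ τ))) := by
        rw [← Finset.sum_add_distrib]
        refine Finset.sum_congr rfl fun t _ => ?_
        rw [h.simplexUtility_dotProduct hA ℓ τ t, ← stateAt_snd, dotProduct_single, mul_one]
        unfold contUtility
        rw [dotProduct_contUtility, dotProduct_contUtility]
        change ℓ t ⬝ᵥ (devMatrix τ ρ).mulVec (A.nextMixed (A.stateAt ℓ t))
          - ℓ t ⬝ᵥ A.nextMixed (A.stateAt ℓ t) = _
        unfold simplexUtility conts
        ring
    _ ≤ ε / 2 * T + ε / 2 * T := add_le_add h1 h2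
    _ = ε * T := by ring

end Params

end ExtensiveGame

/-! ### Natural sampling -/

theorem prod_eq_prod_mul_of_eq_off {ι : Type*} [Fintype ι] [DecidableEq ι] {f g : ι → ℝ} {k : ι}
    (hne : ∀ l, l ≠ k → f l = g l) (hk : g k = 1) : ∏ l, f l = (∏ l, g l) * f k := by
  rw [← Finset.prod_erase_mul _ f (Finset.mem_univ k),
    ← Finset.prod_erase_mul _ g (Finset.mem_univ k), hk, mul_one]
  congr 1
  exact Finset.prod_congr rfl fun l hl => hne l (Finset.ne_of_mem_erase hl)

theorem sum_pi_prod_eq_prod_sum {ι : Type*} [Fintype ι] [DecidableEq ι] {κ : ι → Type*}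
    [∀ k, Fintype (κ k)] (f : (k : ι) → κ k → ℝ) :
    ∑ p : (k : ι) → κ k, ∏ k, f k (p k) = ∏ k, ∑ a, f k a := by
  rw [Finset.prod_univ_sum, Fintype.piFinset_univ]

namespace ExtensiveGame

variable {n : ℕ} {G : ExtensiveGame n} {i : Fin n}

/-- The local strategy at `j` of a sequence-form strategy; it is arbitrary (here uniform) if the
parent sequence of `j` has no mass. -/
noncomputable def behavior (q : G.Seq i → ℝ) (j : G.Info i) : G.Act i j → ℝ :=
  if q (seqI j) = 0 then regretMatch 0 else fun a => q (some ⟨j, a⟩) / q (seqI j)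

theorem sum_behavior {q : G.Seq i → ℝ} (hq : q ∈ G.Q i) (j : G.Info i) :
    ∑ a, behavior q j a = 1 := by
  unfold behavior
  split_ifs with h
  · exact (regretMatch_mem_stdSimplex 0).2
  · rw [← Finset.sum_div, ← hq.2.2 j, div_self h]

theorem eq_seqI_mul_behavior {q : G.Seq i → ℝ} (hq : q ∈ G.Q i) (j : G.Info i) (a : G.Act i j) :
    q (some ⟨j, a⟩) = q (seqI j) * behavior q j a := by
  unfold behavior
  split_ifs with h
  · have h0 := hq.2.2 j
    rw [h, eq_comm, Finset.sum_eq_zero_iff_of_nonneg fun a _ => hq.1 _] at h0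
    rw [h, zero_mul, h0 a (Finset.mem_univ a)]
  · rw [mul_div_cancel₀ _ h]

/-- The own moves of which a sequence consists. -/
def chain : G.Seq i → List (G.Trig i)
  | none => []
  | some τ => τ :: G.past i τ.1

theorem chain_seqI (j : G.Info i) : chain (seqI j) = G.past i j := by
  cases h : seqI j with
  | none => rw [past_eq_nil_of_seqI_eq_none h]; rfl
  | some τ => rw [past_eq_of_seqI_eq_some h]; rfl

open Classical in
/-- Indicator of the actions at `j` that are compatible with the sequence `σ`. -/
noncomputable def compat (σ : G.Seq i) (j : G.Info i) (a : G.Act i j) : ℝ :=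
  if ∀ a', (⟨j, a'⟩ : G.Trig i) ∈ chain σ → a = a' then 1 else 0

theorem compat_none (j : G.Info i) (a : G.Act i j) : compat none j a = 1 := by
  simp [compat, chain]

theorem compat_self (j : G.Info i) (a b : G.Act i j) :
    compat (some ⟨j, a⟩) j b = if b = a then 1 else 0 := by
  classical
  unfold compat
  congr 1
  simp only [chain, List.mem_cons, InfoLT.not_mem_past, or_false, eq_iff_iff]
  constructor
  · exact fun h => h a rfl
  · rintro rfl a' h
    exact (eq_of_heq (Sigma.mk.inj h).2).symm

theorem compat_seqI_self (j : G.Info i) (b : G.Act i j) : compat (seqI j) j b = 1 := by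
  simp [compat, chain_seqI, InfoLT.not_mem_past]

theorem compat_of_ne {j j' : G.Info i} (h : j' ≠ j) (a : G.Act i j) (b : G.Act i j') :
    compat (some ⟨j, a⟩) j' b = compat (seqI j) j' b := by
  classical
  unfold compat
  have hc : chain (some ⟨j, a⟩ : G.Seq i) = ⟨j, a⟩ :: chain (seqI j) := by
    rw [chain_seqI]
    rfl
  rw [hc]
  simp [h]

/-- The deterministic strategy that plays the actions prescribed by `f` wherever it is visited. -/
noncomputable def pureOf (f : (j : G.Info i) → G.Act i j) (σ : G.Seq i) : ℝ :=
  ∏ j, compat σ j (f j)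

theorem pureOf_none (f : (j : G.Info i) → G.Act i j) : pureOf f none = 1 := by
  simp [pureOf, compat_none]

theorem pureOf_some (f : (j : G.Info i) → G.Act i j) (j : G.Info i) (a : G.Act i j) :
    pureOf f (some ⟨j, a⟩) = pureOf f (seqI j) * if f j = a then 1 else 0 := by
  rw [← compat_self]
  exact prod_eq_prod_mul_of_eq_off (fun j' h => compat_of_ne h a (f j')) (compat_seqI_self j (f j))

theorem pureOf_eq_zero_or_one (f : (j : G.Info i) → G.Act i j) (σ : G.Seq i) :
    pureOf f σ = 0 ∨ pureOf f σ = 1 := by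
  classical
  by_cases h : ∃ j, compat σ j (f j) = 0
  · obtain ⟨j, hj⟩ := h
    exact Or.inl (Finset.prod_eq_zero (Finset.mem_univ j) hj)
  · refine Or.inr (Finset.prod_eq_one fun j _ => ?_)
    have : compat σ j (f j) = 1 ∨ compat σ j (f j) = 0 := ite_eq_or_eq _ _ _
    exact this.resolve_right fun h0 => h ⟨j, h0⟩

theorem pureOf_mem_Pure (f : (j : G.Info i) → G.Act i j) : pureOf f ∈ G.Pure i := by
  refine ⟨⟨fun σ => ?_, pureOf_none f, fun j => ?_⟩, pureOf_eq_zero_or_one f⟩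
  · rcases pureOf_eq_zero_or_one f σ with h | h <;> rw [h]
    exact zero_le_one
  · simp [pureOf_some]

theorem eq_of_mem_Pure {π : G.Seq i → ℝ} (hπ : π ∈ G.Pure i) {j : G.Info i} {a a' : G.Act i j}
    (h : π (some ⟨j, a⟩) = 1) (h' : π (some ⟨j, a'⟩) = 1) : a = a' := by
  by_contra hne
  have h1 := hπ.1.2.2 j
  rw [← Finset.add_sum_erase _ _ (Finset.mem_univ a), h] at h1
  have h2 : π (some ⟨j, a'⟩) ≤ ∑ a ∈ Finset.univ.erase a, π (some ⟨j, a⟩) :=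
    Finset.single_le_sum (f := fun a => π (some ⟨j, a⟩)) (fun a _ => hπ.1.1 _)
      (Finset.mem_erase.2 ⟨Ne.symm hne, Finset.mem_univ a'⟩)
  linarith [le_one_of_mem_Q hπ.1 (seqI j)]

theorem seqI_eq_one_of_mem_Pure {π : G.Seq i → ℝ} (hπ : π ∈ G.Pure i) {j : G.Info i}
    {a : G.Act i j} (h : π (some ⟨j, a⟩) = 1) : π (seqI j) = 1 := by
  refine (hπ.2 _).resolve_left fun h0 => ?_
  rw [hπ.1.2.2 j, Finset.sum_eq_zero_iff_of_nonneg fun a _ => hπ.1.1 _] at h0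
  linarith [h0 a (Finset.mem_univ a)]

theorem pureOf_eq_iff {π : G.Seq i → ℝ} (hπ : π ∈ G.Pure i) (f : (j : G.Info i) → G.Act i j) :
    pureOf f = π ↔ ∀ j a, π (some ⟨j, a⟩) = 1 → f j = a := by
  constructor
  · rintro rfl j a h
    by_contra hne
    rw [pureOf_some, if_neg hne, mul_zero] at h
    exact zero_ne_one h
  · intro h
    have hrec : ∀ j a, π (some ⟨j, a⟩) = π (seqI j) * if f j = a then 1 else 0 := by
      intro j a
      have hoff : ∀ a, f j ≠ a → π (some ⟨j, a⟩) = 0 := fun a hne =>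
        (hπ.2 _).resolve_right fun h1 => hne (h j a h1)
      split_ifs with hfa
      · rw [mul_one, hπ.1.2.2 j, Finset.sum_eq_single a]
        · exact fun a' _ hne => hoff a' fun e => hne (e ▸ hfa)
        · simp
      · rw [mul_zero, hoff a hfa]
    have hseq : ∀ j : G.Info i, pureOf f (seqI j) = π (seqI j) := by
      intro j
      induction j using seqI_induction with
      | root j hj => rw [hj, pureOf_none, hπ.1.2.1]
      | step j τ hτ ih =>
        obtain ⟨j', a'⟩ := τ
        rw [hτ, pureOf_some, hrec, ih]
    funext σ
    rcases σ with _ | ⟨j, a⟩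
    · rw [pureOf_none, hπ.1.2.1]
    · rw [pureOf_some, hrec, hseq]

/-- If a deterministic strategy visits an information set whose parent sequence has no mass, then it
makes, on the way, a move of probability zero at an information set of positive mass. -/
theorem exists_zero_move {q : G.Seq i → ℝ} (hq : q ∈ G.Q i) {π : G.Seq i → ℝ} (hπ : π ∈ G.Pure i)
    (j : G.Info i) (h1 : π (seqI j) = 1) (h0 : q (seqI j) = 0) :
    ∃ τ : G.Trig i, π (some τ) = 1 ∧ q (some τ) = 0 ∧ q (seqI τ.1) ≠ 0 := by
  induction j using seqI_induction with
  | root j hj => rw [hj, hq.2.1] at h0; exact absurd h0 one_ne_zero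
  | step j τ hτ ih =>
    rw [hτ] at h0 h1
    by_cases hz : q (seqI τ.1) = 0
    · exact ih (seqI_eq_one_of_mem_Pure (a := τ.2) hπ h1) hz
    · exact ⟨τ, h1, h0, hz⟩

open Classical in
theorem sampleProb_eq_prod_behavior {q : G.Seq i → ℝ} (hq : q ∈ G.Q i) (π : G.Pure i) :
    sampleProb q π = ∏ τ : G.Trig i with π.1 (some τ) = 1, behavior q τ.1 τ.2 := by
  unfold sampleProb
  by_cases h : ∃ τ : G.Trig i, π.1 (some τ) = 1 ∧ q (some τ) = 0 ∧ q (seqI τ.1) ≠ 0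
  · obtain ⟨τ, h1, h0, hne⟩ := h
    have hm : τ ∈ Finset.univ.filter (fun τ : G.Trig i => π.1 (some τ) = 1) := by simpa using h1
    rw [Finset.prod_eq_zero hm (by rw [h0, zero_div]), Finset.prod_eq_zero hm]
    have := eq_seqI_mul_behavior hq τ.1 τ.2
    rw [show q (some ⟨τ.1, τ.2⟩) = 0 from h0] at this
    exact (mul_eq_zero.1 this.symm).resolve_left hne
  · refine Finset.prod_congr rfl fun τ hτ => ?_
    have h1 := (Finset.mem_filter.1 hτ).2
    rw [behavior, if_neg]
    exact fun h0 => h (exists_zero_move hq π.2 τ.1 (seqI_eq_one_of_mem_Pure (a := τ.2) π.2 h1) h0)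

open Classical in
/-- Natural sampling draws an action at every information set independently and forgets the actions
at the information sets that are not visited. -/
theorem sum_prod_behavior_fiber {q : G.Seq i → ℝ} (hq : q ∈ G.Q i) (π : G.Pure i) :
    ∑ f : (j : G.Info i) → G.Act i j with (⟨pureOf f, pureOf_mem_Pure f⟩ : G.Pure i) = π,
      ∏ j, behavior q j (f j) = sampleProb q π := by
  have h1 : ∀ f : (j : G.Info i) → G.Act i j,
      (if (⟨pureOf f, pureOf_mem_Pure f⟩ : G.Pure i) = π then ∏ j, behavior q j (f j) else 0) =
      ∏ j, if ∀ a, π.1 (some ⟨j, a⟩) = 1 → f j = a then behavior q j (f j) else 0 := by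
    intro f
    have hp := (Subtype.ext_iff (a1 := ⟨pureOf f, pureOf_mem_Pure f⟩) (a2 := π)).trans
      (pureOf_eq_iff π.2 f)
    by_cases hf : ∀ j a, π.1 (some ⟨j, a⟩) = 1 → f j = a
    · rw [if_pos (hp.2 hf)]
      exact Finset.prod_congr rfl fun j _ => (if_pos (hf j)).symm
    · rw [if_neg (mt hp.1 hf)]
      push Not at hf
      obtain ⟨j, a, h, hne⟩ := hf
      exact (Finset.prod_eq_zero (Finset.mem_univ j) (if_neg fun h' => hne (h' a h))).symm
  rw [Finset.sum_filter, Finset.sum_congr rfl fun f _ => h1 f,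
    sum_pi_prod_eq_prod_sum
      (fun j b => if ∀ a, π.1 (some ⟨j, a⟩) = 1 → b = a then behavior q j b else 0),
    sampleProb_eq_prod_behavior hq, Finset.prod_filter, Fintype.prod_sigma]
  refine Finset.prod_congr rfl fun j _ => ?_
  by_cases hj : ∃ a, π.1 (some ⟨j, a⟩) = 1
  · obtain ⟨a, ha⟩ := hj
    have hiff : ∀ b, (∀ a', π.1 (some ⟨j, a'⟩) = 1 → b = a') ↔ b = a := fun b =>
      ⟨fun h => h a ha, fun h a' ha' => h.trans (eq_of_mem_Pure π.2 ha ha')⟩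
    have hiff' : ∀ b, π.1 (some ⟨j, b⟩) = 1 ↔ b = a := fun b =>
      ⟨fun h => eq_of_mem_Pure π.2 h ha, fun h => h ▸ ha⟩
    simp [hiff']
  · have hall : ∀ a, ¬ π.1 (some ⟨j, a⟩) = 1 := fun a h => hj ⟨a, h⟩
    simp [hall, sum_behavior hq]

/-- The probability that independent draws at all information sets are compatible with a sequence is
the product of the move probabilities along it. -/
theorem sum_prod_behavior_mul_pureOf {q : G.Seq i → ℝ} (hq : q ∈ G.Q i) (σ : G.Seq i) :
    ∑ f : (j : G.Info i) → G.Act i j, (∏ j, behavior q j (f j)) * pureOf f σ = q σ := by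
  have hE : ∀ σ, ∑ f : (j : G.Info i) → G.Act i j, (∏ j, behavior q j (f j)) * pureOf f σ =
      ∏ j, ∑ a, behavior q j a * compat σ j a := fun σ => by
    simp only [pureOf, ← Finset.prod_mul_distrib]
    exact sum_pi_prod_eq_prod_sum fun j a => behavior q j a * compat σ j a
  rw [hE]
  have hrec : ∀ j a, ∏ j', ∑ b, behavior q j' b * compat (some ⟨j, a⟩) j' b =
      (∏ j', ∑ b, behavior q j' b * compat (seqI j) j' b) * behavior q j a := by
    intro j a
    rw [prod_eq_prod_mul_of_eq_off (k := j)
      (g := fun j' => ∑ b, behavior q j' b * compat (seqI j) j' b)]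
    · simp [compat_self]
    · intro j' h
      simp only [compat_of_ne h]
    · simp only [compat_seqI_self, mul_one, sum_behavior hq]
  have hnone : ∏ j, ∑ a, behavior q j a * compat none j a = q none := by
    simp [compat_none, sum_behavior hq, hq.2.1]
  have hseq : ∀ j : G.Info i,
      ∏ j', ∑ a, behavior q j' a * compat (seqI j) j' a = q (seqI j) := by
    intro j
    induction j using seqI_induction with
    | root j hj => rw [hj, hnone]
    | step j τ hτ ih =>
      obtain ⟨j', a'⟩ := τ
      rw [hτ, hrec, ih, eq_seqI_mul_behavior hq]
  rcases σ with _ | ⟨j, a⟩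
  · exact hnone
  · rw [hrec, hseq, eq_seqI_mul_behavior hq]

/-- The sampled deterministic strategy is an unbiased estimate of the mixed strategy. -/
theorem sum_sampleProb_mul {q : G.Seq i → ℝ} (hq : q ∈ G.Q i) (σ : G.Seq i) :
    ∑ π : G.Pure i, sampleProb q π * π.1 σ = q σ := by
  classical
  rw [← sum_prod_behavior_mul_pureOf hq σ,
    ← Finset.sum_fiberwise Finset.univ
      (fun f => (⟨pureOf f, pureOf_mem_Pure f⟩ : G.Pure i))]
  refine Finset.sum_congr rfl fun π _ => ?_
  rw [← sum_prod_behavior_fiber hq π, Finset.sum_mul]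
  refine Finset.sum_congr rfl fun f hf => ?_
  rw [← (Finset.mem_filter.1 hf).2]

theorem sum_sampleProb {q : G.Seq i → ℝ} (hq : q ∈ G.Q i) :
    ∑ π : G.Pure i, sampleProb q π = 1 := by
  rw [← hq.2.1, ← sum_sampleProb_mul hq none]
  exact Finset.sum_congr rfl fun π _ => by rw [π.2.1.2.1, mul_one]

end ExtensiveGame

/-! ### Trigger gains and correlated equilibria -/

namespace ExtensiveGame

variable {n : ℕ} {G : ExtensiveGame n} {i : Fin n}

/-- The gain of player `i` from the trigger deviation `(τ, ρ)` if the others play according to `p`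
and the player's own strategy is `x`. -/
noncomputable def gain (τ : G.Trig i) (ρ : G.Seq i → ℝ) (p : G.Profile) (x : G.Seq i → ℝ) : ℝ :=
  utility i p ⬝ᵥ (devMatrix τ ρ).mulVec x - utility i p ⬝ᵥ x

/-- The probability, up to chance, that the players other than `i` allow the terminal node `z` to be
reached. -/
noncomputable def othersReach (i : Fin n) (p : G.Profile) (z : G.Z) : ℝ :=
  ∏ i' ∈ Finset.univ.erase i, (p i').1 (G.seqZ i' z)

theorem utility_dotProduct (p : G.Profile) (x : G.Seq i → ℝ) :
    utility i p ⬝ᵥ x = ∑ z : G.Z,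
      G.tree.payoff z i * G.tree.chanceProb z * othersReach i p z * x (G.seqZ i z) := by
  classical
  rw [← Finset.sum_fiberwise Finset.univ (G.seqZ i)]
  refine Finset.sum_congr rfl fun σ _ => ?_
  unfold utility
  rw [Finset.sum_mul]
  refine Finset.sum_congr ?_ fun z hz => ?_
  · congr!
  · rw [(Finset.mem_filter.1 hz).2]
    rfl

open Classical in
/-- The change of a strategy `x` at the sequence `σ` under the trigger deviation `(τ, ρ)`. -/
noncomputable def devChange (τ : G.Trig i) (ρ : G.Seq i → ℝ) (x : G.Seq i → ℝ) (σ : G.Seq i) : ℝ :=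
  (if InfoLESeq τ.1 σ then ρ σ * x (some τ) else 0) - (if TrigLE τ σ then x σ else 0)

theorem gain_eq_sum (τ : G.Trig i) (ρ : G.Seq i → ℝ) (p : G.Profile) (x : G.Seq i → ℝ) :
    gain τ ρ p x = ∑ z : G.Z, G.tree.payoff z i * G.tree.chanceProb z * othersReach i p z
      * devChange τ ρ x (G.seqZ i z) := by
  classical
  unfold gain
  rw [← dotProduct_sub, utility_dotProduct]
  refine Finset.sum_congr rfl fun z _ => ?_
  rw [Pi.sub_apply, devMatrix_mulVec]
  congr 1
  unfold devChange
  by_cases h : TrigLE τ (G.seqZ i z)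
  · simp only [h, if_true]
    ring
  · simp only [h, if_false]
    ring

theorem prod_eq_ite_of_Pure (s : Finset (Fin n)) (p : G.Profile) (σ : (i : Fin n) → G.Seq i)
    [Decidable (∀ i ∈ s, (p i).1 (σ i) = 1)] :
    ∏ i ∈ s, (p i).1 (σ i) = if ∀ i ∈ s, (p i).1 (σ i) = 1 then 1 else 0 := by
  split_ifs with h
  · exact Finset.prod_eq_one h
  · push Not at h
    obtain ⟨i, hi, hne⟩ := h
    exact Finset.prod_eq_zero hi (((p i).2.2 _).resolve_right hne)

theorem reach_eq_sum (i : Fin n) (μ : G.Profile → ℝ) (z : G.Z) :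
    reach μ z = ∑ p, μ p * (othersReach i p z * (p i).1 (G.seqZ i z)) := by
  classical
  unfold reach othersReach
  rw [Finset.sum_filter]
  refine Finset.sum_congr rfl fun p _ => ?_
  rw [Finset.prod_erase_mul _ (fun i' => (p i').1 (G.seqZ i' z)) (Finset.mem_univ i),
    prod_eq_ite_of_Pure Finset.univ p fun i' => G.seqZ i' z]
  simp

theorem reachTrig_eq_sum (μ : G.Profile → ℝ) (τ : G.Trig i) (ρ : G.Seq i → ℝ) (z : G.Z) :
    reachTrig μ τ ρ z =
      ∑ p, μ p * (othersReach i p z * (ρ (G.seqZ i z) * (p i).1 (some τ))) := by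
  classical
  unfold reachTrig othersReach
  rw [Finset.sum_filter, Finset.sum_mul]
  refine Finset.sum_congr rfl fun p _ => ?_
  rw [prod_eq_ite_of_Pure (Finset.univ.erase i) p fun i' => G.seqZ i' z]
  rcases (p i).2.2 (some τ) with h | h <;>
    by_cases h' : ∀ i', i' ≠ i → (p i').1 (G.seqZ i' z) = 1 <;>
    simp [h, h']

/-- The two sides of the equilibrium condition differ by the expected gain from the deviation. -/
theorem isApproxEFCE_iff {ε : ℝ} {μ : G.Profile → ℝ} : G.IsApproxEFCE ε μ ↔
    μ ∈ stdSimplex ℝ G.Profile ∧ ∀ (i : Fin n) (τ : G.Trig i), ∀ ρ ∈ PureSub τ.1,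
      ∑ p, μ p * gain τ ρ p (p i).1 ≤ ε := by
  classical
  unfold IsApproxEFCE
  refine and_congr_right fun _ => forall_congr' fun i => forall_congr' fun τ =>
    forall_congr' fun ρ => forall_congr' fun _ => ?_
  have h : ∑ p, μ p * gain τ ρ p (p i).1 =
      ∑ z : G.Z with InfoLESeq τ.1 (G.seqZ i z),
        G.tree.payoff z i * G.tree.chanceProb z * reachTrig μ τ ρ z
      - ∑ z : G.Z with TrigLE τ (G.seqZ i z),
        G.tree.payoff z i * G.tree.chanceProb z * reach μ z := by
    simp only [gain_eq_sum, Finset.mul_sum]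
    rw [Finset.sum_comm, Finset.sum_filter, Finset.sum_filter, ← Finset.sum_sub_distrib]
    refine Finset.sum_congr rfl fun z _ => ?_
    rw [reachTrig_eq_sum, reach_eq_sum i]
    by_cases h1 : InfoLESeq τ.1 (G.seqZ i z) <;> by_cases h2 : TrigLE τ (G.seqZ i z) <;>
      simp only [devChange, h1, h2, if_true, if_false, Finset.mul_sum, ← Finset.sum_sub_distrib,
        sub_zero, zero_sub, mul_zero, Finset.sum_const_zero, ← Finset.sum_neg_distrib] <;>
      exact Finset.sum_congr rfl fun p _ => by ring
  rw [h]
  constructor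
  · intro h'
    linarith
  · intro h'
    linarith

theorem sum_sampleProb_mul_devChange {q : G.Seq i → ℝ} (hq : q ∈ G.Q i) (τ : G.Trig i)
    (ρ : G.Seq i → ℝ) (σ : G.Seq i) :
    ∑ π : G.Pure i, sampleProb q π * (devChange τ ρ π.1 σ - devChange τ ρ q σ) = 0 := by
  classical
  simp only [mul_sub, Finset.sum_sub_distrib, ← Finset.sum_mul, sum_sampleProb hq, one_mul]
  rw [sub_eq_zero]
  simp only [devChange, mul_sub, Finset.sum_sub_distrib]
  congr 1
  · split_ifs
    · rw [← sum_sampleProb_mul hq (some τ), Finset.mul_sum]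
      exact Finset.sum_congr rfl fun π _ => by ring
    · simp
  · split_ifs
    · exact sum_sampleProb_mul hq σ
    · simp

/-- If the players sample independently, then the gain from a trigger deviation has the same
expectation for the sampled strategy as for the mixed strategy. -/
theorem sum_prod_sampleProb_mul_gain_sub {q : (i' : Fin n) → G.Seq i' → ℝ}
    (hq : q i ∈ G.Q i) (τ : G.Trig i) (ρ : G.Seq i → ℝ) :
    ∑ p : G.Profile, (∏ i', sampleProb (q i') (p i')) *
      (gain τ ρ p (p i).1 - gain τ ρ p (q i)) = 0 := by
  classical
  simp only [gain_eq_sum, ← Finset.sum_sub_distrib, Finset.mul_sum]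
  rw [Finset.sum_comm]
  refine Finset.sum_eq_zero fun z _ => ?_
  set f : (i' : Fin n) → G.Pure i' → ℝ := Function.update
    (fun i' π => sampleProb (q i') π * π.1 (G.seqZ i' z)) i
    (fun π => sampleProb (q i) π *
      (devChange τ ρ π.1 (G.seqZ i z) - devChange τ ρ (q i) (G.seqZ i z))) with hf
  have hprod : ∀ p : G.Profile, ∏ i', f i' (p i') = (∏ i', sampleProb (q i') (p i')) *
      (othersReach i p z *
        (devChange τ ρ (p i).1 (G.seqZ i z) - devChange τ ρ (q i) (G.seqZ i z))) := by
    intro p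
    rw [← Finset.mul_prod_erase _ (fun i' => f i' (p i')) (Finset.mem_univ i),
      ← Finset.mul_prod_erase _ (fun i' => sampleProb (q i') (p i')) (Finset.mem_univ i)]
    have h1 : ∏ i' ∈ Finset.univ.erase i, f i' (p i') =
        ∏ i' ∈ Finset.univ.erase i, sampleProb (q i') (p i') * (p i').1 (G.seqZ i' z) :=
      Finset.prod_congr rfl fun i' hi' => by
        rw [hf, Function.update_of_ne (Finset.ne_of_mem_erase hi')]
    rw [h1, Finset.prod_mul_distrib, hf, Function.update_self]
    unfold othersReach
    ring
  have hzero : ∏ i', ∑ π, f i' π = 0 := by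
    refine Finset.prod_eq_zero (Finset.mem_univ i) ?_
    rw [hf, Function.update_self]
    exact sum_sampleProb_mul_devChange hq τ ρ _
  rw [← sum_pi_prod_eq_prod_sum f] at hzero
  rw [← mul_zero (G.tree.payoff z i * G.tree.chanceProb z), ← hzero, Finset.mul_sum]
  refine Finset.sum_congr rfl fun p _ => ?_
  rw [hprod]
  ring

theorem exists_utility_bound (i : Fin n) : ∃ B : ℝ, ∀ (p : G.Profile) σ, |utility i p σ| ≤ B := by
  obtain ⟨B, hB⟩ :=
    (Set.finite_range fun x : G.Profile × G.Seq i => |utility i x.1 x.2|).bddAbove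
  exact ⟨B, fun p σ => hB ⟨(p, σ), rfl⟩⟩

theorem abs_gain_le {B : ℝ} (hB : ∀ (p : G.Profile) σ, |utility i p σ| ≤ B) {τ : G.Trig i}
    {ρ : G.Seq i → ℝ} (hρ : ρ ∈ QSub τ.1) (p : G.Profile) {x : G.Seq i → ℝ} (hx : x ∈ G.Q i) :
    |gain τ ρ p x| ≤ Fintype.card (G.Seq i) * (B * 2) + Fintype.card (G.Seq i) * B :=
  (abs_sub _ _).trans (add_le_add
    (abs_dotProduct_le_mul (hB p) (abs_devMatrix_mulVec_le hρ hx))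
    (abs_dotProduct_le (hB p) (abs_le_one_of_mem_Q hx)))

/-! ### Convergence of the empirical frequency of play -/

theorem sum_empirical_mul (π : ℕ → G.Profile) (f : G.Profile → ℝ) (T : ℕ) :
    ∑ p, empirical π T p * f p = (∑ t ∈ Finset.range T, f (π t)) / T := by
  classical
  unfold empirical
  simp only [mul_assoc, Finset.sum_mul, ← Finset.mul_sum]
  rw [Finset.sum_comm, one_div, div_eq_inv_mul]
  congr 1
  refine Finset.sum_congr rfl fun t _ => ?_
  simp

theorem empirical_mem_stdSimplex (π : ℕ → G.Profile) {T : ℕ} (hT : 1 ≤ T) :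
    empirical π T ∈ stdSimplex ℝ G.Profile := by
  classical
  refine ⟨fun p => ?_, ?_⟩
  · exact mul_nonneg (by positivity)
      (Finset.sum_nonneg fun t _ => by split_ifs <;> norm_num)
  · have h := sum_empirical_mul π (fun _ => 1) T
    have hT0 : (T : ℝ) ≠ 0 := by positivity
    simpa [hT0] using h

theorem pureSub_finite (j : G.Info i) : (PureSub j).Finite := by
  refine Set.Finite.subset (Set.Finite.pi' (t := fun _ : G.Seq i => ({0, 1} : Set ℝ))
    (fun _ => Set.toFinite _)) ?_
  intro q hq σ
  simpa using hq.2 σ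

/-- Almost surely, the average gain of a player from a trigger deviation is asymptotically at most
zero: the regret of the mixed strategies is sublinear, and the sampled strategies behave like the
mixed ones by the strong law. -/
theorem IsPlay.ae_eventually_average_gain_le {Ω : Type*} [MeasurableSpace Ω] {P : Measure Ω}
    [IsProbabilityMeasure P] {A : (i : Fin n) → G.Params i} {π : ℕ → Ω → G.Profile}
    (hπ : IsPlay P A π) (hA : (A i).Admissible) (hR : (A i).NoRegret) (τ : G.Trig i)
    {ρ : G.Seq i → ℝ} (hρ : ρ ∈ QSub τ.1) :
    ∀ᵐ ω ∂P, ∀ ε : ℝ, 0 < ε → ∀ᶠ T : ℕ in atTop,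
      (∑ t ∈ Finset.range T, gain τ ρ (π t ω) (π t ω i).1) / T ≤ ε := by
  obtain ⟨B, hB⟩ := exists_utility_bound (G := G) i
  have hlaw := ae_tendsto_average_of_transition hπ.1 hπ.2
    (D := fun h p => gain τ ρ p (p i).1 - gain τ ρ p ((A i).mixed (h.map (utility i))))
    (fun h p => (abs_sub _ _).trans (add_le_add (abs_gain_le hB hρ p (p i).2.1)
      (abs_gain_le hB hρ p (hR.mixed_mem_Q hA _))))
    (fun h => sum_prod_sampleProb_mul_gain_sub (i := i)
      (q := fun i' => (A i').mixed (h.map (utility i'))) (hR.mixed_mem_Q hA _) τ ρ)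
  filter_upwards [hlaw] with ω hω ε hε
  have hreg := hR.eventually_trigger_regret_le hA (ℓ := fun t => utility i (π t ω))
    (fun t => hB (π t ω)) τ (half_pos hε)
  filter_upwards [hreg, hω.eventually (ge_mem_nhds (half_pos hε)), eventually_ge_atTop 1]
    with T h1 h2 hT
  have hT0 : (0 : ℝ) < T := by exact_mod_cast hT
  have h1 := h1 ρ hρ
  rw [div_le_iff₀ hT0] at h2 ⊢
  simp only [List.map_map] at h2
  rw [Finset.sum_sub_distrib, sub_le_iff_le_add] at h2
  refine h2.trans ((add_le_add le_rfl h1).trans_eq ?_)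
  ring

end ExtensiveGame

/-- A sequence in a compact set that satisfies a family of continuous inequalities asymptotically
converges to the set of the solutions of these inequalities. -/
theorem tendsto_infEDist_of_eventually_le {E ι : Type*} [PseudoEMetricSpace E] {K : Set E}
    (hK : IsCompact K) {μ : ℕ → E} (hμ : ∀ᶠ T in atTop, μ T ∈ K) {L : ι → E → ℝ}
    (hL : ∀ c, Continuous (L c)) (h : ∀ c, ∀ ε : ℝ, 0 < ε → ∀ᶠ T in atTop, L c (μ T) ≤ ε)
    {S : Set E} (hS : ∀ x ∈ K, (∀ c, L c x ≤ 0) → x ∈ S) :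
    Tendsto (fun T => Metric.infEDist (μ T) S) atTop (𝓝 0) := by
  rw [ENNReal.tendsto_nhds_zero]
  intro ε hε
  by_contra hcon
  obtain ⟨φ, hφ, hφ'⟩ := extraction_of_frequently_atTop
    ((not_eventually.1 hcon).and_eventually hμ)
  obtain ⟨x, hx, ψ, hψ, hlim⟩ := hK.tendsto_subseq fun k => (hφ' k).2
  have hatTop : Tendsto (φ ∘ ψ) atTop atTop := (hφ.comp hψ).tendsto_atTop
  have hxS : x ∈ S := by
    refine hS x hx fun c => le_of_forall_pos_le_add fun δ hδ => ?_
    rw [zero_add]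
    exact le_of_tendsto (((hL c).tendsto x).comp hlim) (hatTop.eventually (h c δ hδ))
  have hdist : Tendsto (fun k => edist (μ (φ (ψ k))) x) atTop (𝓝 0) :=
    tendsto_iff_edist_tendsto_0.1 hlim
  obtain ⟨k, hk⟩ := (hdist.eventually (ge_mem_nhds hε)).exists
  exact (hφ' (ψ k)).1 ((Metric.infEDist_le_edist_of_mem hxS).trans hk)

theorem mainTheorem3 {n : ℕ} (G : ExtensiveGame n)
    (A : (i : Fin n) → G.Params i) (hA : ∀ i, (A i).Admissible)
    (hR : ∀ i, (A i).UsesCFR ∨ (A i).NoRegret)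
    {Ω : Type*} [MeasurableSpace Ω] (P : Measure Ω) [IsProbabilityMeasure P]
    (π : ℕ → Ω → G.Profile) (hπ : ExtensiveGame.IsPlay P A π) :
    ∀ᵐ ω ∂P, Tendsto
      (fun T : ℕ => Metric.infEDist (ExtensiveGame.empirical (fun t => π t ω) T) G.EFCE)
      atTop (𝓝 0) := by
  have hN : ∀ i, (A i).NoRegret := fun i => (hR i).elim (fun h => h.noRegret) id
  have hae : ∀ᵐ ω ∂P, ∀ (i : Fin n) (τ : G.Trig i), ∀ ρ ∈ ExtensiveGame.PureSub τ.1,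
      ∀ ε : ℝ, 0 < ε → ∀ᶠ T : ℕ in atTop,
        (∑ t ∈ Finset.range T, ExtensiveGame.gain τ ρ (π t ω) (π t ω i).1) / T ≤ ε :=
    ae_all_iff.2 fun i => ae_all_iff.2 fun τ =>
      (ae_ball_iff (ExtensiveGame.pureSub_finite τ.1).countable).2 fun ρ hρ =>
        hπ.ae_eventually_average_gain_le (hA i) (hN i) τ hρ.1
  filter_upwards [hae] with ω hω
  refine tendsto_infEDist_of_eventually_le
    (ι := (i : Fin n) × (τ : G.Trig i) × ExtensiveGame.PureSub τ.1)
    (L := fun c μ => ∑ p, μ p * ExtensiveGame.gain c.2.1 c.2.2.1 p (p c.1).1)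
    (isCompact_stdSimplex ℝ G.Profile)
    ((eventually_ge_atTop 1).mono fun T hT => ExtensiveGame.empirical_mem_stdSimplex _ hT)
    (fun c => by fun_prop) (fun c ε hε => ?_) (fun μ hμ h => ?_)
  · simp only [ExtensiveGame.sum_empirical_mul]
    exact hω c.1 c.2.1 c.2.2.1 c.2.2.2 ε hε
  · exact ExtensiveGame.isApproxEFCE_iff.2 ⟨hμ, fun i τ ρ hρ => h ⟨i, τ, ρ, hρ⟩⟩
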